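/- **Construction.** For an ordinal $\alpha$, let $T(\alpha)$ be the lattice of length 3 with bottom $0$, top $1$, atoms $g_\iota$ ($\iota<6+\alpha$) and coatoms $g^{\iota\mu}$ ($\iota<\mu<6+\alpha$), where $g_\iota<g^{\kappa\mu}$ iff $\iota\in\{\kappa,\mu\}$. Let $T'(\alpha)$ be its dual, with coatoms $h^\iota$ and atoms $h_{\iota\mu}$ corresponding to $g_\iota$ and $g^{\iota\mu}$, respectively. Let $M'_{3\times3}$ be the following 15-element lattice: it consists of the grid $\{0,1,2\}^2$ with the componentwise order; a new doubly irreducible element in the middle of each of the four cells, covering $(i,j)$ and covered by $(i+1,j+1)$, for $i,j\in\{0,1\}$; and two further doubly irreducible elements $e,f$ with $(2,0)\prec e\prec(2,2)$ and $(0,0)\prec f\prec(0,2)$. Let $a=(1,0)$ be its distinguished atom and $c=(1,2)$ its distinguished coatom. Let $N_{11}$ be the 11-element lattice of length 3 with atoms $p_0,\dots,p_3$ and coatoms $q_0,\dots,q_4$ such that the sets of atoms below $q_0,\dots,q_4$ are $\{p_0,p_1,p_2\}$, $\{p_2,p_3\}$, $\{p_2\}$, $\{p_0\}$, $\{p_3\}$,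 respectively. Given a lattice $M$ with a distinguished atom $a$ and a distinguished coatom $c$, and a bounded lattice $N$, form the Hall--Dilworth gluing of $M$ (below) and $T(\alpha)$ (above) along the filter $\{c,1\}$ of $M$ and the ideal $\{0,g_0\}$ of $T(\alpha)$. Then form the Hall--Dilworth gluing of $T'(\alpha)$ (below) and the lattice just obtained (above) along the filter $\{h^0,1\}$ of $T'(\alpha)$ and the ideal $\{0,a\}$. In the resulting lattice, for all $\iota<\mu<6+\alpha$, replace each of the edges $g_\iota\prec g^{\iota\mu}$ and $h_{\iota\mu}\prec h^\mu$ with its own copy of $N$, and each of the edges $g_\mu\prec g^{\iota\mu}$ and $h_{\iota\mu}\prec h^\iota$ with its own copy of the dual of $N$ (the bottom and the top of a copy are identified with the endpoints of the edge). Denote the result by $S_{M,a,c,N}(\alpha)$, and let $S(\alpha)$ be the case $M=M'_{3\times3}$, $N=N_{11}$. **Statement.** For every ordinal $\alpha$, $S(\alpha)$ is an automorphism-rigid (that is, its only automorphism is the identity) simple selfdual lattice of length 12. Moreover, $S(\alpha)\cong S(\beta)$ if and only if $\alpha=\beta$. Furthermore, (i) $M'_{3\times 3}$ with $a=(1,0)$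 and $c=(1,2)$ is a simple lattice of length 4, it has a dual automorphism interchanging the atom $a$ and the coatom $c$, and its only automorphism fixing $a$ and $c$ is the identity; (ii) $N_{11}$ is an automorphism-rigid simple lattice of length 3 that is not selfdual; and (iii) for any $(M,a,c)$ with the properties listed in (i) and any $N$ with the properties listed in (ii), the same conclusions hold: for every ordinal $\alpha$, $S_{M,a,c,N}(\alpha)$ is an automorphism-rigid simple selfdual lattice of length 12, and $S_{M,a,c,N}(\alpha)\cong S_{M,a,c,N}(\beta)$ if and only if $\alpha=\beta$. -/

import Mathlib

universe u v w

/-! ### Lattice-theoretic properties of a partially ordered set -/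

/-- The partially ordered set `X` is a lattice (the lattice operations are determined by the order)
and this lattice is simple: it has more than one element, and its only congruences are
the equality relation and the full relation. -/
def IsSimpleLattice (X : Type u) [P : PartialOrder X] : Prop :=
  ∃ L : Lattice X, L.toPartialOrder = P ∧ Nontrivial X ∧
    ∀ θ : LatticeCon X, (∀ x y : X, θ.r x y → x = y) ∨ (∀ x y : X, θ.r x y)

/-- `X` is isomorphic to its dual. -/
def IsSelfdual (X : Type u) [PartialOrder X] : Prop :=
  Nonempty (X ≃o Xᵒᵈ)

/-- The identity is the only automorphism. -/
def IsAutomorphismRigid (X : Type u) [PartialOrder X] : Prop :=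
  ∀ f : X ≃o X, f = OrderIso.refl X

/-- `X` is of length `n`: the supremum of the lengths of its finite chains is `n`,
where a chain of `k + 1` elements has length `k`. -/
def HasLength (X : Type u) [PartialOrder X] (n : ℕ) : Prop :=
  Order.krullDim X = (n : WithBot ℕ∞)

/-! ### The lattices `T` -/

/-- The underlying set of the Frucht lattice of the complete graph on a linearly ordered vertex
set `I`: bottom, top, an atom `g_i` for each vertex `i`, and a coatom `g^{ij}` for each pair
`i < j` of vertices. -/
inductive FruchtT (I : Type u) [LinearOrder I] : Type u
  | bot : FruchtT I
  | top : FruchtT I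
  | atom (i : I) : FruchtT I
  | coatom (i j : I) (h : i < j) : FruchtT I

namespace FruchtT

variable {I : Type u} [LinearOrder I]

/-- The order: `g_i < g^{km}` if and only if `i ∈ {k, m}`. -/
def le : FruchtT I → FruchtT I → Prop
  | bot, _ => True
  | _, top => True
  | atom i, atom k => i = k
  | atom i, coatom k m _ => i = k ∨ i = m
  | coatom i j _, coatom k m _ => i = k ∧ j = m
  | _, _ => False

instance : PartialOrder (FruchtT I) where
  le := le
  le_refl x := by cases x <;> simp [le]
  le_trans x y z := by
    cases x <;> cases y <;> cases z <;> simp only [le] <;> grind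
  le_antisymm x y := by
    cases x <;> cases y <;> simp only [le] <;> grind

instance : BoundedOrder (FruchtT I) where
  bot := bot
  top := top
  bot_le x := by cases x <;> trivial
  le_top x := by cases x <;> trivial

end FruchtT

/-! ### Hall–Dilworth gluing along two-element chains -/

/-- The underlying set of the Hall–Dilworth gluing of `A` (below) and `B` (above) along the
two-element filter `{c, ⊤}` of `A` and the two-element ideal `{⊥, g}` of `B`, where `c` is a coatom
of `A` and `g` is an atom of `B`. Here `c = ⊥_B` and `⊤_A = g` are identified, so the set consists
of the elements of `A` and of the elements of `B` other than `⊥` and `g`. -/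
inductive Glue (A : Type u) (B : Type v) [PartialOrder B] [OrderBot B] (c : A) (g : B) :
    Type (max u v)
  | lower (x : A) : Glue A B c g
  | upper (y : B) (h : y ≠ ⊥ ∧ y ≠ g) : Glue A B c g

namespace Glue

variable {A : Type u} {B : Type v} [PartialOrder A] [PartialOrder B] [OrderBot B] {c : A} {g : B}

/-- The order of the gluing: it extends the orders of `A` and `B`, and `x ∈ A` lies below
`y ∈ B` if and only if `x ≤ z` in `A` and `z ≤ y` in `B` for some `z` in the common part, which is
`{c = ⊥_B, ⊤_A = g}`. -/
def le : Glue A B c g → Glue A B c g → Prop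
  | lower x, lower x' => x ≤ x'
  | lower x, upper y _ => x ≤ c ∨ g ≤ y
  | upper _ _, lower _ => False
  | upper y _, upper y' _ => y ≤ y'

instance : PartialOrder (Glue A B c g) where
  le := le
  le_refl x := by cases x <;> simp [le]
  le_trans x y z := by
    cases x <;> cases y <;> cases z <;> simp only [le] <;> grind
  le_antisymm x y := by
    cases x <;> cases y <;> simp only [le] <;> grind

instance [OrderBot A] : OrderBot (Glue A B c g) where
  bot := lower ⊥
  bot_le x := by
    cases x with
    | lower x => exact (bot_le : (⊥ : A) ≤ x)
    | upper y h => exact Or.inl bot_le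

open Classical in
/-- The canonical map of `B` into the gluing. -/
noncomputable def ofUpper [OrderTop A] (y : B) : Glue A B c g :=
  if h : y ≠ ⊥ ∧ y ≠ g then upper y h else if y = ⊥ then lower c else lower ⊤

theorem ofUpper_eq_upper [OrderTop A] {y : B} (h : y ≠ ⊥ ∧ y ≠ g) :
    (ofUpper y : Glue A B c g) = upper y h :=
  dif_pos h

theorem ofUpper_lt_upper [OrderTop A] {x y : B} (h : y ≠ ⊥ ∧ y ≠ g) (hxy : x < y) :
    (ofUpper x : Glue A B c g) < upper y h := by
  unfold ofUpper
  split_ifs with h1 h2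
  · exact lt_of_le_of_ne hxy.le (fun h => hxy.ne (by injection h))
  · exact lt_of_le_of_ne (Or.inl le_rfl) nofun
  · have h3 : x = g := by tauto
    exact lt_of_le_of_ne (Or.inr (h3 ▸ hxy.le)) nofun

end Glue

/-! ### Replacing edges by lattices -/

/-- A family of distinct edges of `L`, the edge with index `e` going from `lo e` up to `hi e`,
together with a mark that tells for which edges the inserted lattice is to be turned
upside down. -/
structure EdgeFamily (L : Type u) [PartialOrder L] (E : Type v) where
  lo : E → L
  hi : E → L
  reversed : E → Bool
  lo_lt_hi : ∀ e, lo e < hi e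

/-- The elements of `N` other than its bottom and its top. -/
abbrev Interior (N : Type w) [PartialOrder N] [BoundedOrder N] : Type w :=
  {x : N // x ≠ ⊥ ∧ x ≠ ⊤}

/-- The underlying set of what we obtain from `L` if each edge `e` of the family `F` is replaced
with its own copy of `N` (with its own copy of the dual of `N` if `e` is marked as reversed):
the bottom and the top of the copy are identified with `lo e` and `hi e`, so only the interior
elements of the copies are new. -/
inductive EdgeReplace {L : Type u} [PartialOrder L] {E : Type v} (F : EdgeFamily L E)
    (N : Type w) [PartialOrder N] [BoundedOrder N] : Type (max u v w)
  | base (x : L) : EdgeReplace F N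
  | inner (e : E) (s : Interior N) : EdgeReplace F N

namespace EdgeReplace

variable {L : Type u} [PartialOrder L] {E : Type v} {F : EdgeFamily L E}
    {N : Type w} [PartialOrder N] [BoundedOrder N]

/-- The order: it extends the order of `L` and the orders of the inserted copies of `N` or of its
dual; otherwise, an interior element of the copy at `e` is above exactly what is
below `lo e` and is below exactly what is above `hi e`. -/
def le : EdgeReplace F N → EdgeReplace F N → Prop
  | base x, base y => x ≤ y
  | base x, inner e _ => x ≤ F.lo e
  | inner e _, base y => F.hi e ≤ y
  | inner e s, inner e' t =>
      (e = e' ∧ if F.reversed e then t ≤ s else s ≤ t) ∨ F.hi e ≤ F.lo e'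

instance : PartialOrder (EdgeReplace F N) where
  le := le
  le_refl x := by cases x <;> simp [le]
  le_trans x y z := by
    have h := F.lo_lt_hi
    cases x <;> cases y <;> cases z <;> simp only [le] <;> grind
  le_antisymm x y := by
    have h := F.lo_lt_hi
    cases x <;> cases y <;> simp only [le] <;> grind

end EdgeReplace

/-! ### The lattices `S(α)` -/

/-- The ordinals `ι < 6 + α`. -/
abbrev Idx (α : Ordinal.{u}) : Type (u + 1) := Set.Iio (6 + α)

/-- The ordinal `0` as an index. -/
def idxZero (α : Ordinal.{u}) : Idx α :=
  ⟨0, lt_of_lt_of_le (by norm_num : (0 : Ordinal.{u}) < 6) le_self_add⟩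

section construction

variable (M : Type) [PartialOrder M] [BoundedOrder M] (a c : M) (α : Ordinal.{u})

/-- The lattice `T(α)`. -/
abbrev TLat : Type (u + 1) := FruchtT (Idx α)

/-- The gluing of `M` and `T(α)` along the filter `{c, 1}` of `M` and the principal ideal
`{0, g_0}` of `T(α)`. -/
abbrev UpperPart : Type (u + 1) :=
  Glue M (TLat α) c (FruchtT.atom (idxZero α))

/-- The lattice `S_0(α)`: the gluing of the dual `T'(α)` of `T(α)` and `UpperPart` along the
principal filter `{h^0, 1}` of `T'(α)` and the ideal `{0, a}` of `UpperPart`. In `T'(α)`, the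
coatom `h^i` is the dual of `g_i` and the atom `h_{ij}` is the dual of `g^{ij}`. -/
abbrev S0 : Type (u + 1) :=
  Glue (TLat α)ᵒᵈ (UpperPart M c α)
    (OrderDual.toDual (FruchtT.atom (idxZero α))) (Glue.lower a)

/-- The canonical map of `T(α)` into `S_0(α)`. -/
noncomputable def S0.up (x : TLat α) : S0 M a c α :=
  Glue.ofUpper (Glue.ofUpper x)

/-- The canonical map of `T'(α)`, the elements of which are viewed as the elements
of `T(α)`, into `S_0(α)`. -/
def S0.down (x : TLat α) : S0 M a c α :=
  Glue.lower (OrderDual.toDual x)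

end construction

/-- The four kinds of the edges to be replaced. -/
inductive EdgeKind : Type
  | upperLeft | upperRight | lowerLeft | lowerRight

/-- An index of an edge to be replaced: a pair `i < j` and one of the four kinds. -/
structure SEdge (α : Ordinal.{u}) : Type (u + 1) where
  i : Idx α
  j : Idx α
  lt : i < j
  kind : EdgeKind

section construction

variable (M : Type) [PartialOrder M] [BoundedOrder M] (a c : M) (α : Ordinal.{u})

/-- Lower ends: `g_i`, `g_j`, `h_{ij}`, `h_{ij}`. -/
noncomputable def SEdge.lo : SEdge α → S0 M a c α
  | ⟨i, _, _, .upperLeft⟩ => S0.up M a c α (.atom i)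
  | ⟨_, j, _, .upperRight⟩ => S0.up M a c α (.atom j)
  | ⟨i, j, h, .lowerLeft⟩ => S0.down M a c α (.coatom i j h)
  | ⟨i, j, h, .lowerRight⟩ => S0.down M a c α (.coatom i j h)

/-- Upper ends: `g^{ij}`, `g^{ij}`, `h^i`, `h^j`. -/
noncomputable def SEdge.hi : SEdge α → S0 M a c α
  | ⟨i, j, h, .upperLeft⟩ => S0.up M a c α (.coatom i j h)
  | ⟨i, j, h, .upperRight⟩ => S0.up M a c α (.coatom i j h)
  | ⟨i, _, _, .lowerLeft⟩ => S0.down M a c α (.atom i)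
  | ⟨_, j, _, .lowerRight⟩ => S0.down M a c α (.atom j)

/-- Upper right and lower left edges receive the dual lattice. -/
def SEdge.reversed : SEdge α → Bool
  | ⟨_, _, _, .upperLeft⟩ => false
  | ⟨_, _, _, .upperRight⟩ => true
  | ⟨_, _, _, .lowerLeft⟩ => true
  | ⟨_, _, _, .lowerRight⟩ => false

theorem S0.up_atom_lt_up_coatom (k i j : Idx α) (h : i < j) (hk : k = i ∨ k = j) :
    S0.up M a c α (.atom k) < S0.up M a c α (.coatom i j h) := by
  have h1 : (FruchtT.coatom i j h : TLat α) ≠ ⊥ ∧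
      FruchtT.coatom i j h ≠ FruchtT.atom (idxZero α) :=
    ⟨(nofun : FruchtT.coatom i j h ≠ FruchtT.bot), nofun⟩
  have h2 : (Glue.upper (FruchtT.coatom i j h) h1 : UpperPart M c α) ≠ ⊥ ∧
      (Glue.upper (FruchtT.coatom i j h) h1 : UpperPart M c α) ≠ Glue.lower a :=
    ⟨(nofun : Glue.upper (FruchtT.coatom i j h) h1 ≠ Glue.lower ⊥), nofun⟩
  have h3 : (FruchtT.atom k : TLat α) < FruchtT.coatom i j h :=
    lt_of_le_of_ne hk nofun
  have h4 : S0.up M a c α (.coatom i j h) = Glue.upper (Glue.upper (FruchtT.coatom i j h) h1) h2 := by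
    rw [S0.up, Glue.ofUpper_eq_upper h1, Glue.ofUpper_eq_upper h2]
  rw [h4]
  exact Glue.ofUpper_lt_upper _ (Glue.ofUpper_lt_upper _ h3)

theorem S0.down_coatom_lt_down_atom (k i j : Idx α) (h : i < j) (hk : k = i ∨ k = j) :
    S0.down M a c α (.coatom i j h) < S0.down M a c α (.atom k) :=
  lt_of_le_of_ne hk nofun

/-- All edges to be replaced. -/
noncomputable def SEdge.family : EdgeFamily (S0 M a c α) (SEdge α) where
  lo := SEdge.lo M a c α
  hi := SEdge.hi M a c α
  reversed := SEdge.reversed α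
  lo_lt_hi := by
    rintro ⟨i, j, h, _ | _⟩
    · exact S0.up_atom_lt_up_coatom M a c α i i j h (Or.inl rfl)
    · exact S0.up_atom_lt_up_coatom M a c α j i j h (Or.inr rfl)
    · exact S0.down_coatom_lt_down_atom M a c α i i j h (Or.inl rfl)
    · exact S0.down_coatom_lt_down_atom M a c α j i j h (Or.inr rfl)

/-- The ordered set obtained from `S_0(α)` (constructed with `M`, `a`, and `c`) by replacing the
upper left and lower right edges with copies of `N`, and the upper right and lower left edges with
copies of the dual of `N`. -/
abbrev SLat (N : Type) [PartialOrder N] [BoundedOrder N] : Type (u + 1) :=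
  EdgeReplace (SEdge.family M a c α) N

end construction

/-! ### The two diagrams -/

/-- The underlying set of `M'_{3×3}`: the `3 × 3` grid, an element `mid i j` in the middle of each
of the four cells of the grid, and two more elements, `e` and `f`. -/
inductive M33 : Type
  | grid (i j : Fin 3) : M33
  | mid (i j : Fin 2) : M33
  | e : M33
  | f : M33
  deriving DecidableEq, Fintype

namespace M33

/-- The largest element of the grid below a given element. -/
def floor : M33 → Fin 3 × Fin 3
  | grid i j => (i, j)
  | mid i j => (i.castSucc, j.castSucc)
  | e => (2, 0)
  | f => (0, 0)

/-- The smallest element of the grid above a given element. -/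
def ceil : M33 → Fin 3 × Fin 3
  | grid i j => (i, j)
  | mid i j => (i.succ, j.succ)
  | e => (2, 2)
  | f => (0, 2)

/-- The grid is the direct square of the three-element chain; each of the other elements `x` is
doubly irreducible, with lower cover `floor x` and upper cover `ceil x`. -/
instance : PartialOrder M33 where
  le x y := x = y ∨ ceil x ≤ floor y
  le_refl x := Or.inl rfl
  le_trans := by
    have h : ∀ x, floor x ≤ ceil x := by decide
    rintro x y z (rfl | h1) (rfl | h2)
    · exact Or.inl rfl
    · exact Or.inr h2
    · exact Or.inr h1
    · exact Or.inr ((h1.trans (h y)).trans h2)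
  le_antisymm := by decide +revert

instance : BoundedOrder M33 where
  bot := grid 0 0
  top := grid 2 2
  bot_le _ := Or.inr (Prod.mk_le_mk.2 ⟨Fin.zero_le _, Fin.zero_le _⟩)
  le_top _ := Or.inr (Prod.mk_le_mk.2 ⟨Fin.le_last _, Fin.le_last _⟩)

end M33

/-- The underlying set of `N_11`: bottom, top, four atoms, and five coatoms. -/
inductive N11 : Type
  | bot : N11
  | top : N11
  | atom (i : Fin 4) : N11
  | coatom (j : Fin 5) : N11
  deriving DecidableEq, Fintype

namespace N11

/-- The atoms below a given coatom. -/
def atomsBelow : Fin 5 → Finset (Fin 4)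
  | 0 => {0, 1, 2}
  | 1 => {2, 3}
  | 2 => {2}
  | 3 => {0}
  | 4 => {3}

/-- The order of `N_11`. -/
def le : N11 → N11 → Prop
  | bot, _ => True
  | _, top => True
  | atom i, atom k => i = k
  | atom i, coatom j => i ∈ atomsBelow j
  | coatom j, coatom k => j = k
  | _, _ => False

instance : PartialOrder N11 where
  le := le
  le_refl x := by cases x <;> simp [le]
  le_trans x y z := by
    cases x <;> cases y <;> cases z <;> simp only [le] <;> grind
  le_antisymm x y := by
    cases x <;> cases y <;> simp only [le] <;> grind

instance : BoundedOrder N11 where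
  bot := bot
  top := top
  bot_le x := by cases x <;> trivial
  le_top x := by cases x <;> trivial

end N11

/-- The lattice `S(α)`, constructed from `M'_{3×3}` with the distinguished atom `(1, 0)` and the
distinguished coatom `(1, 2)` of the grid, and from `N_11`. -/
abbrev S (α : Ordinal.{u}) : Type (u + 1) :=
  SLat M33 (M33.grid 1 0) (M33.grid 1 2) α N11

/-! ### Other diagrams that serve the same purpose -/

/-- `M` is a simple lattice of length 4 with a distinguished atom `a` and a distinguished
coatom `c`, there is a dual automorphism of `M` that interchanges `a` and `c`, and the only
automorphism of `M` that fixes `a` and `c` is the identity. -/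
structure IsConnector (M : Type) [PartialOrder M] [BoundedOrder M] (a c : M) : Prop where
  simple : IsSimpleLattice M
  length : HasLength M 4
  atom : IsAtom a
  coatom : IsCoatom c
  selfdual : ∃ δ : M ≃o Mᵒᵈ, δ a = OrderDual.toDual c ∧ δ c = OrderDual.toDual a
  rigid : ∀ f : M ≃o M, f a = a → f c = c → f = OrderIso.refl M

/-- `N` is an automorphism-rigid simple lattice of length 3 that is not selfdual. -/
structure IsEdgeFiller (N : Type) [PartialOrder N] [BoundedOrder N] : Prop where
  simple : IsSimpleLattice N
  length : HasLength N 3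
  rigid : IsAutomorphismRigid N
  not_selfdual : ¬ IsSelfdual N

/-! ### Congruences of ordered sets -/

section OrderCongruence

variable {X : Type u} {Y : Type v} [PartialOrder X] [PartialOrder Y]

/-! Simplicity survives every construction step because each piece shares an edge with what it is
attached to. A congruence restricts to every piece and is trivial or full there. If it is full on
one of two glued pieces, it collapses the shared edge and hence is full on the other. If it is
trivial on all pieces, a collapsed pair `x < y` straddling two of them would still collapse a
nontrivial interval inside one (`Glue.isSimpleOrderedSet`, `EdgeReplace.isSimpleOrderedSet`, with
`FruchtT.isSimpleOrderedSet` for the pieces `T(α)`). Only a partial order is given on `S(α)`, so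
congruences are expressed through existing joins and meets of pairs.

Selfduality: exchange `T(α)` with `T'(α)` and apply to `M` its dual automorphism swapping `a` and
`c`. The edges marked as reversed are distributed so that copies of `N` are matched with copies of
its dual. Length: a strictly increasing function into `{0, …, 12}` and a chain of 13 elements.

Isomorphisms: the atoms of `S(α)` are the `h_{ij}`, and the joins of two distinct atoms are the
`h^i` together with the top of `T'(α)`, which is the greatest of these joins. Hence an isomorphism
`S(α) ≅ S(β)` induces a bijection `σ` of the indices. The interval from `h_{ij}` to `h^i` is `N` or
its dual, according to whether `j < i` or `i < j`; since `N` is not selfdual, `σ` preserves the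
order (`SLat.map_copy`). So `6 + α = 6 + β`, and `α = β` by left cancellation.

For an automorphism, `σ` is the identity because the indices are well ordered, and rigidity of `N`
then fixes everything below `a`. By duality everything above `c` is fixed. What remains is the copy
of `M`, an interval with fixed endpoints in which `a` and `c` are fixed, so the rigidity hypothesis
on `M` applies. -/

theorem isLUB_pair_iff {x y z : X} :
    IsLUB {x, y} z ↔ x ≤ z ∧ y ≤ z ∧ ∀ w, x ≤ w → y ≤ w → z ≤ w := by
  simp [IsLUB, IsLeast, mem_lowerBounds, and_assoc]

theorem isGLB_pair_iff {x y z : X} :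
    IsGLB {x, y} z ↔ z ≤ x ∧ z ≤ y ∧ ∀ w, w ≤ x → w ≤ y → w ≤ z := by
  simp [IsGLB, IsGreatest, mem_upperBounds, and_assoc]

theorem isLUB_pair_of_le {x y : X} (h : x ≤ y) : IsLUB {x, y} y :=
  isLUB_pair_iff.2 ⟨h, le_rfl, fun _ _ h => h⟩

theorem isLUB_pair_of_ge {x y : X} (h : y ≤ x) : IsLUB {x, y} x :=
  isLUB_pair_iff.2 ⟨le_rfl, h, fun _ h _ => h⟩

theorem isGLB_pair_of_le {x y : X} (h : x ≤ y) : IsGLB {x, y} x :=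
  isGLB_pair_iff.2 ⟨le_rfl, h, fun _ h _ => h⟩

theorem isGLB_pair_of_ge {x y : X} (h : y ≤ x) : IsGLB {x, y} y :=
  isGLB_pair_iff.2 ⟨h, le_rfl, fun _ _ h => h⟩

/-- An equivalence relation that is compatible with all existing binary joins and meets. -/
structure IsOrderCongruence (r : X → X → Prop) : Prop where
  equiv : Equivalence r
  lub : ∀ {x y z s t : X}, r x y → IsLUB {x, z} s → IsLUB {y, z} t → r s t
  glb : ∀ {x y z s t : X}, r x y → IsGLB {x, z} s → IsGLB {y, z} t → r s t

variable (X) in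
/-- The order of a simple lattice, described without reference to the lattice operations. -/
structure IsSimpleOrderedSet : Prop where
  exists_isLUB : ∀ x y : X, ∃ z, IsLUB {x, y} z
  exists_isGLB : ∀ x y : X, ∃ z, IsGLB {x, y} z
  nontrivial : Nontrivial X
  eq_or_full : ∀ r : X → X → Prop, IsOrderCongruence r →
    (∀ x y, r x y → x = y) ∨ ∀ x y, r x y

/-- A map that preserves binary joins and meets. -/
structure PreservesJoinMeet (φ : X → Y) : Prop where
  lub : ∀ {x y z : X}, IsLUB {x, y} z → IsLUB {φ x, φ y} (φ z)
  glb : ∀ {x y z : X}, IsGLB {x, y} z → IsGLB {φ x, φ y} (φ z)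

namespace IsOrderCongruence

variable {r : X → X → Prop}

theorem comap (hr : IsOrderCongruence r) {φ : Y → X} (hφ : PreservesJoinMeet φ) :
    IsOrderCongruence fun x y => r (φ x) (φ y) where
  equiv := ⟨fun _ => hr.equiv.refl _, fun h => hr.equiv.symm h, fun h h' => hr.equiv.trans h h'⟩
  lub h hs ht := hr.lub h (hφ.lub hs) (hφ.lub ht)
  glb h hs ht := hr.glb h (hφ.glb hs) (hφ.glb ht)

theorem interval (hr : IsOrderCongruence r) {u x y v : X} (h : r u v) (hux : u ≤ x) (hxy : x ≤ y)
    (hyv : y ≤ v) : r x y := by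
  have h1 : r x v := hr.lub (z := x) h (isLUB_pair_of_le hux) (isLUB_pair_of_ge (hxy.trans hyv))
  exact hr.glb (z := y) h1 (isGLB_pair_of_le hxy) (isGLB_pair_of_ge hyv)

/-- Related elements are both related to their join, so a congruence is determined by the comparable
pairs that it collapses. -/
theorem eq_of_not_lt (hr : IsOrderCongruence r) (hX : ∀ x y : X, ∃ z, IsLUB {x, y} z)
    (h : ∀ u v, u < v → ¬ r u v) (x y : X) (hxy : r x y) : x = y := by
  obtain ⟨s, hs⟩ := hX x y
  have key : ∀ u v, r u v → IsLUB {u, v} s → v = s := fun u v huv hs => by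
    have h1 : r s v := hr.lub huv hs (isLUB_pair_of_le le_rfl)
    by_contra hne
    exact h v s (lt_of_le_of_ne (isLUB_pair_iff.1 hs).2.1 hne) (hr.equiv.symm h1)
  rw [key x y hxy hs, key y x (hr.equiv.symm hxy) (Set.pair_comm x y ▸ hs)]

theorem full_of_le (hr : IsOrderCongruence r) {p q : X} (hp : ∀ x, p ≤ x) (hq : ∀ x, x ≤ q)
    (h : r p q) (x y : X) : r x y :=
  hr.equiv.trans (hr.equiv.symm (hr.interval h le_rfl (hp x) (hq x)))
    (hr.interval h le_rfl (hp y) (hq y))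

end IsOrderCongruence

namespace IsSimpleOrderedSet

theorem dual (h : IsSimpleOrderedSet X) : IsSimpleOrderedSet Xᵒᵈ where
  exists_isLUB x y := h.exists_isGLB (OrderDual.ofDual x) (OrderDual.ofDual y)
  exists_isGLB x y := h.exists_isLUB (OrderDual.ofDual x) (OrderDual.ofDual y)
  nontrivial := h.nontrivial
  eq_or_full r hr := h.eq_or_full r
    ⟨hr.equiv, fun h hs ht => hr.glb h hs ht, fun h hs ht => hr.lub h hs ht⟩

theorem isSimpleLattice (h : IsSimpleOrderedSet X) : IsSimpleLattice X := by
  choose s hs using h.exists_isLUB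
  choose i hi using h.exists_isGLB
  simp only [isLUB_pair_iff, isGLB_pair_iff] at hs hi
  let L : Lattice X :=
    { (inferInstance : PartialOrder X) with
      sup := s
      inf := i
      le_sup_left := fun x y => (hs x y).1
      le_sup_right := fun x y => (hs x y).2.1
      sup_le := fun x y z h1 h2 => (hs x y).2.2 z h1 h2
      inf_le_left := fun x y => (hi x y).1
      inf_le_right := fun x y => (hi x y).2.1
      le_inf := fun x y z h1 h2 => (hi y z).2.2 x h1 h2 }
  refine ⟨L, rfl, h.nontrivial, fun θ => h.eq_or_full θ.r ⟨θ.iseqv, ?_, ?_⟩⟩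
  · intro x y z p q hxy hp hq
    rw [hp.unique (isLUB_pair (a := x) (b := z)), hq.unique (isLUB_pair (a := y) (b := z))]
    exact θ.sup hxy (θ.iseqv.refl z)
  · intro x y z p q hxy hp hq
    rw [hp.unique (isGLB_pair (a := x) (b := z)), hq.unique (isGLB_pair (a := y) (b := z))]
    exact θ.inf hxy (θ.iseqv.refl z)

end IsSimpleOrderedSet

theorem IsSimpleLattice.isSimpleOrderedSet {X : Type u} [P : PartialOrder X]
    (h : IsSimpleLattice X) : IsSimpleOrderedSet X := by
  obtain ⟨L, rfl, hn, h⟩ := h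
  refine ⟨fun x y => ⟨x ⊔ y, isLUB_pair⟩, fun x y => ⟨x ⊓ y, isGLB_pair⟩, hn, fun r hr => ?_⟩
  refine h ⟨⟨r, hr.equiv⟩, fun {w x y z} h1 h2 => ?_, fun {w x y z} h1 h2 => ?_⟩
  · refine hr.equiv.trans (y := x ⊓ y) (hr.glb h1 isGLB_pair isGLB_pair) ?_
    rw [inf_comm x y, inf_comm x z]
    exact hr.glb h2 isGLB_pair isGLB_pair
  · refine hr.equiv.trans (y := x ⊔ y) (hr.lub h1 isLUB_pair isLUB_pair) ?_
    rw [sup_comm x y, sup_comm x z]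
    exact hr.lub h2 isLUB_pair isLUB_pair

/-- Two surjections onto ordered sets that induce the same preorder on related elements
yield an isomorphism. -/
theorem exists_orderIso_of_surjective {P : Type*} {Q : Type*} {π : P → X} {ρ : Q → Y}
    (hπ : π.Surjective) (hρ : ρ.Surjective) {s : P → Q} (hs : s.Surjective)
    (h : ∀ p q, π p ≤ π q ↔ ρ (s p) ≤ ρ (s q)) :
    ∃ F : X ≃o Y, ∀ p, F (π p) = ρ (s p) := by
  -- Two preimages of one point are below each other under `π`, hence also under `ρ ∘ s`; the chosen
  -- preimage does not matter.
  have hl : ∀ p, ρ (s (Function.surjInv hπ (π p))) = ρ (s p) := fun p => by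
    have := Function.surjInv_eq hπ (π p)
    exact le_antisymm ((h _ _).1 this.le) ((h _ _).1 this.ge)
  let F : X ↪o Y := OrderEmbedding.ofMapLEIff (fun x => ρ (s (Function.surjInv hπ x))) fun x y => by
    rw [← h, Function.surjInv_eq hπ, Function.surjInv_eq hπ]
  refine ⟨RelIso.ofSurjective F fun y => ?_, hl⟩
  obtain ⟨q, rfl⟩ := hρ y
  obtain ⟨p, rfl⟩ := hs q
  exact ⟨π p, hl p⟩

/-- An isomorphism that matches the images of two order embeddings lifts to their domains. -/
theorem exists_orderIso_of_embedding {P : Type*} {Q : Type*} [PartialOrder P] [PartialOrder Q]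
    {φ : P → X} {ψ : Q → Y} (hφ : ∀ p q, φ p ≤ φ q ↔ p ≤ q) (hψ : ∀ p q, ψ p ≤ ψ q ↔ p ≤ q)
    (f : X ≃o Y) (h : ∀ p, ∃ q, f (φ p) = ψ q) (h' : ∀ q, ∃ p, f (φ p) = ψ q) :
    ∃ F : P ≃o Q, ∀ p, f (φ p) = ψ (F p) := by
  choose F hF using h
  let G : P ↪o Q := OrderEmbedding.ofMapLEIff F fun x y => by
    rw [← hψ, ← hF, ← hF, f.le_iff_le, hφ]
  refine ⟨RelIso.ofSurjective G fun q => ?_, hF⟩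
  obtain ⟨p, hp⟩ := h' q
  refine ⟨p, ?_⟩
  have : ψ (F p) = ψ q := (hF p).symm.trans hp
  exact le_antisymm ((hψ _ _).1 this.le) ((hψ _ _).1 this.ge)

end OrderCongruence

/-! ### Gluings -/

namespace Glue

variable {A : Type u} {B : Type v} [PartialOrder A] [PartialOrder B] [OrderBot B] {c : A} {g : B}

@[simp] theorem lower_le_lower {x y : A} : (lower x : Glue A B c g) ≤ lower y ↔ x ≤ y := Iff.rfl

@[simp] theorem lower_le_upper {x : A} {y : B} {h} :
    (lower x : Glue A B c g) ≤ upper y h ↔ x ≤ c ∨ g ≤ y := Iff.rfl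

@[simp] theorem not_upper_le_lower {x : A} {y : B} {h} :
    ¬ (upper y h : Glue A B c g) ≤ lower x := id

@[simp] theorem upper_le_upper {x y : B} {h h'} :
    (upper x h : Glue A B c g) ≤ upper y h' ↔ x ≤ y := Iff.rfl

theorem preservesJoinMeet_lower : PreservesJoinMeet (lower : A → Glue A B c g) where
  lub := by
    simp only [isLUB_pair_iff]
    rintro x y z ⟨h1, h2, h3⟩
    refine ⟨h1, h2, ?_⟩
    -- If an upper bound `w` in `B` is not above `g`, then both elements are below `c`, and so is
    -- their join.
    rintro (w | ⟨w, hw⟩) <;> simp only [lower_le_lower, lower_le_upper] <;> grind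
  glb := by
    simp only [isGLB_pair_iff]
    rintro x y z ⟨h1, h2, h3⟩
    refine ⟨h1, h2, ?_⟩
    rintro (w | ⟨w, hw⟩)
    · exact h3 w
    · exact fun h => h.elim

variable [OrderTop A]

@[simp] theorem ofUpper_bot : (ofUpper ⊥ : Glue A B c g) = lower c := by simp [ofUpper]

theorem ofUpper_atom (hg : IsAtom g) : (ofUpper g : Glue A B c g) = lower ⊤ := by
  simp [ofUpper, hg.1]

/-- With the next two lemmas, this describes the order by two overlapping maps from all of `A` and
all of `B`, so that the shared points `c = ⊥` and `⊤ = g` can be viewed from either side. -/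
theorem lower_le_ofUpper (hg : IsAtom g) {x : A} {y : B} :
    (lower x : Glue A B c g) ≤ ofUpper y ↔ x ≤ c ∨ g ≤ y := by
  by_cases h : y ≠ ⊥ ∧ y ≠ g
  · rw [ofUpper_eq_upper h, lower_le_upper]
  · by_cases h' : y = ⊥
    · simp [h', hg.1]
    · obtain rfl : y = g := by tauto
      simp [ofUpper_atom hg]

theorem ofUpper_le_lower (hg : IsAtom g) {x : A} {y : B} :
    (ofUpper y : Glue A B c g) ≤ lower x ↔ y = ⊥ ∧ c ≤ x ∨ y ≤ g ∧ x = ⊤ := by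
  by_cases h : y ≠ ⊥ ∧ y ≠ g
  · rw [ofUpper_eq_upper h, hg.le_iff]
    simp [h]
  · by_cases h' : y = ⊥
    · simp +contextual [h', le_of_eq_of_le]
    · obtain rfl : y = g := by tauto
      simp [ofUpper_atom hg, hg.1]

theorem ofUpper_le_ofUpper (hc : IsCoatom c) (hg : IsAtom g) {x y : B} :
    (ofUpper x : Glue A B c g) ≤ ofUpper y ↔ x ≤ y := by
  by_cases h : x ≠ ⊥ ∧ x ≠ g
  · by_cases h' : y ≠ ⊥ ∧ y ≠ g
    · rw [ofUpper_eq_upper h, ofUpper_eq_upper h', upper_le_upper]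
    · rw [ofUpper_eq_upper h]
      by_cases h2 : y = ⊥
      · simp [h2, h.1]
      · obtain rfl : y = g := by tauto
        simp [ofUpper_atom hg, hg.le_iff, h]
  · by_cases h' : x = ⊥
    · simp [h', lower_le_ofUpper hg]
    · obtain rfl : x = g := by tauto
      rw [ofUpper_atom hg, lower_le_ofUpper hg]
      simp [hc.1]

theorem exists_eq (z : Glue A B c g) : (∃ x, z = lower x) ∨ ∃ y, z = ofUpper y := by
  cases z with
  | lower x => exact Or.inl ⟨x, rfl⟩
  | upper y h => exact Or.inr ⟨y, (ofUpper_eq_upper h).symm⟩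

theorem preservesJoinMeet_ofUpper (hc : IsCoatom c) (hg : IsAtom g) :
    PreservesJoinMeet (ofUpper : B → Glue A B c g) where
  lub := by
    simp only [isLUB_pair_iff]
    rintro x y z ⟨h1, h2, h3⟩
    simp only [ofUpper_le_ofUpper hc hg]
    refine ⟨h1, h2, fun w => ?_⟩
    obtain ⟨w, rfl⟩ | ⟨w, rfl⟩ := exists_eq w
    · simp only [ofUpper_le_lower hg]
      rintro (⟨rfl, h⟩ | ⟨h, rfl⟩) (⟨rfl, h'⟩ | ⟨h', h''⟩)
      · exact Or.inl ⟨le_bot_iff.1 (h3 _ le_rfl le_rfl), h⟩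
      · exact Or.inr ⟨h3 _ bot_le h', h''⟩
      · exact Or.inr ⟨h3 _ h bot_le, rfl⟩
      · exact Or.inr ⟨h3 _ h h', rfl⟩
    · simpa only [ofUpper_le_ofUpper hc hg] using h3 w
  glb := by
    simp only [isGLB_pair_iff]
    rintro x y z ⟨h1, h2, h3⟩
    simp only [ofUpper_le_ofUpper hc hg]
    refine ⟨h1, h2, fun w => ?_⟩
    obtain ⟨w, rfl⟩ | ⟨w, rfl⟩ := exists_eq w
    · simp only [lower_le_ofUpper hg]
      grind
    · simpa only [ofUpper_le_ofUpper hc hg] using h3 w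

theorem exists_isLUB (hc : IsCoatom c) (hg : IsAtom g) (hA : ∀ x y : A, ∃ z, IsLUB {x, y} z)
    (hB : ∀ x y : B, ∃ z, IsLUB {x, y} z) (x y : Glue A B c g) : ∃ z, IsLUB {x, y} z := by
  have mixed : ∀ (x : A) (y : B), ∃ z, IsLUB {(lower x : Glue A B c g), ofUpper y} z := by
    intro x y
    by_cases h : x ≤ c
    · exact ⟨_, isLUB_pair_of_le ((lower_le_ofUpper hg).2 (Or.inl h))⟩
    -- As `c` is a coatom and `x ≰ c`, every upper bound of `x` and `y` is above the shared point `⊤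
    -- = g`; so the join is `g ∨ y`, taken in `B`.
    · obtain ⟨z, hz⟩ := hB g y
      obtain ⟨t, ht⟩ := hA x c
      refine ⟨ofUpper z, ?_⟩
      rw [isLUB_pair_iff] at hz ht ⊢
      simp only [ofUpper_le_ofUpper hc hg, lower_le_ofUpper hg]
      refine ⟨Or.inr hz.1, hz.2.1, fun w => ?_⟩
      obtain ⟨w, rfl⟩ | ⟨w, rfl⟩ := exists_eq w
      · simp only [lower_le_lower, ofUpper_le_lower hg]
        rintro h1 (⟨rfl, h2⟩ | ⟨h2, rfl⟩)
        · refine Or.inr ⟨hz.2.2 _ le_rfl bot_le, ?_⟩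
          rcases hc.le_iff.1 h2 with h3 | rfl
          · exact h3
          · exact (h h1).elim
        · exact Or.inr ⟨hz.2.2 _ le_rfl h2, rfl⟩
      · simp only [lower_le_ofUpper hg, ofUpper_le_ofUpper hc hg, h, false_or]
        exact hz.2.2 w
  obtain ⟨x, rfl⟩ | ⟨x, rfl⟩ := exists_eq x <;> obtain ⟨y, rfl⟩ | ⟨y, rfl⟩ := exists_eq y
  · obtain ⟨z, hz⟩ := hA x y
    exact ⟨_, preservesJoinMeet_lower.lub hz⟩
  · exact mixed x y
  · rw [Set.pair_comm]
    exact mixed y x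
  · obtain ⟨z, hz⟩ := hB x y
    exact ⟨_, (preservesJoinMeet_ofUpper hc hg).lub hz⟩

theorem exists_isGLB (hc : IsCoatom c) (hg : IsAtom g) (hA : ∀ x y : A, ∃ z, IsGLB {x, y} z)
    (hB : ∀ x y : B, ∃ z, IsGLB {x, y} z) (x y : Glue A B c g) : ∃ z, IsGLB {x, y} z := by
  have mixed : ∀ (x : A) (y : B), ∃ z, IsGLB {(lower x : Glue A B c g), ofUpper y} z := by
    intro x y
    by_cases h : g ≤ y
    · exact ⟨_, isGLB_pair_of_le ((lower_le_ofUpper hg).2 (Or.inr h))⟩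
    · obtain ⟨z, hz⟩ := hA x c
      refine ⟨lower z, ?_⟩
      rw [isGLB_pair_iff] at hz ⊢
      refine ⟨hz.1, (lower_le_ofUpper hg).2 (Or.inl hz.2.1), fun w => ?_⟩
      obtain ⟨w, rfl⟩ | ⟨w, rfl⟩ := exists_eq w
      · simp only [lower_le_lower, lower_le_ofUpper hg, h, or_false]
        exact hz.2.2 w
      · simp only [ofUpper_le_lower hg, ofUpper_le_ofUpper hc hg]
        rintro (⟨rfl, h1⟩ | ⟨h1, rfl⟩) h2
        · exact Or.inl ⟨rfl, hz.2.2 _ h1 le_rfl⟩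
        · refine Or.inl ⟨?_, hz.2.2 _ le_top le_rfl⟩
          rcases hg.le_iff.1 h1 with h3 | rfl
          · exact h3
          · exact (h h2).elim
  obtain ⟨x, rfl⟩ | ⟨x, rfl⟩ := exists_eq x <;> obtain ⟨y, rfl⟩ | ⟨y, rfl⟩ := exists_eq y
  · obtain ⟨z, hz⟩ := hA x y
    exact ⟨_, preservesJoinMeet_lower.glb hz⟩
  · exact mixed x y
  · rw [Set.pair_comm]
    exact mixed y x
  · obtain ⟨z, hz⟩ := hB x y
    exact ⟨_, (preservesJoinMeet_ofUpper hc hg).glb hz⟩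

/-- The gluing of two simple lattices along a two-element chain is simple. -/
theorem isSimpleOrderedSet [OrderBot A] [OrderTop B] (hc : IsCoatom c) (hg : IsAtom g)
    (hA : IsSimpleOrderedSet A) (hB : IsSimpleOrderedSet B) :
    IsSimpleOrderedSet (Glue A B c g) where
  exists_isLUB := exists_isLUB hc hg hA.exists_isLUB hB.exists_isLUB
  exists_isGLB := exists_isGLB hc hg hA.exists_isGLB hB.exists_isGLB
  nontrivial := ⟨lower c, lower ⊤, fun h => hc.1 (by injection h)⟩
  eq_or_full r hr := by
    have hu := preservesJoinMeet_ofUpper hc hg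
    -- Collapsing the shared edge makes the congruence full on both parts.
    have hfull : r (lower c) (lower ⊤) → ∀ x y, r x y := fun h => by
      have h1 : ∀ x y : A, r (lower x) (lower y) := by
        rcases hA.eq_or_full _ (hr.comap preservesJoinMeet_lower) with h1 | h1
        · exact (hc.1 (h1 _ _ h)).elim
        · exact h1
      have h2 : ∀ x y : B, r (ofUpper x) (ofUpper y) := by
        rcases hB.eq_or_full _ (hr.comap hu) with h2 | h2
        · refine (hg.1 (h2 ⊥ g ?_).symm).elim
          rwa [ofUpper_bot, ofUpper_atom hg]
        · exact h2
      have h3 := hr.equiv.trans (h1 ⊥ ⊤) (ofUpper_atom (c := c) hg ▸ h2 g ⊤)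
      refine hr.full_of_le (fun x => bot_le) (fun x => ?_) h3
      obtain ⟨x, rfl⟩ | ⟨x, rfl⟩ := exists_eq x
      · exact (lower_le_ofUpper hg).2 (Or.inr le_top)
      · exact (ofUpper_le_ofUpper hc hg).2 le_top
    rcases hA.eq_or_full _ (hr.comap preservesJoinMeet_lower) with h1 | h1
    · rcases hB.eq_or_full _ (hr.comap hu) with h2 | h2
      · left
        refine hr.eq_of_not_lt (exists_isLUB hc hg hA.exists_isLUB hB.exists_isLUB) ?_
        rintro (x | ⟨x, hx⟩) (y | ⟨y, hy⟩) hlt h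
        · exact hlt.ne (congrArg _ (h1 _ _ h))
        -- A pair with `x` in `A` and `y` in `B` has `c` or `⊤ = g` in between; the interval from
        -- there up to `y` lies in `B` and is also collapsed.
        · rcases lower_le_upper.1 hlt.le with h3 | h3
          · rw [← ofUpper_eq_upper hy] at h
            have h4 := hr.interval h h3 ((lower_le_ofUpper hg).2 (Or.inl le_rfl)) le_rfl
            rw [← ofUpper_bot] at h4
            exact hy.1 (h2 _ _ h4).symm
          · rw [← ofUpper_eq_upper hy] at h
            have h4 := hr.interval h (lower_le_lower.2 le_top)
              ((lower_le_ofUpper hg).2 (Or.inr h3)) le_rfl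
            rw [← ofUpper_atom hg] at h4
            exact hy.2 (h2 _ _ h4).symm
        · exact not_upper_le_lower hlt.le
        · rw [← ofUpper_eq_upper hx, ← ofUpper_eq_upper hy] at h
          obtain rfl := h2 _ _ h
          exact hlt.ne rfl
      · refine Or.inr (hfull ?_)
        rw [← ofUpper_atom (c := c) hg, ← ofUpper_bot]
        exact h2 _ _
    · exact Or.inr (hfull (h1 _ _))

end Glue

/-! ### Replaced edges -/

namespace EdgeReplace

variable {L : Type u} [PartialOrder L] {E : Type v} {F : EdgeFamily L E}
    {N : Type w} [PartialOrder N] [BoundedOrder N]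

@[simp] theorem base_le_base {x y : L} : (base x : EdgeReplace F N) ≤ base y ↔ x ≤ y := Iff.rfl

@[simp] theorem base_le_inner {x : L} {e : E} {s : Interior N} :
    (base x : EdgeReplace F N) ≤ inner e s ↔ x ≤ F.lo e := Iff.rfl

@[simp] theorem inner_le_base {x : L} {e : E} {s : Interior N} :
    (inner e s : EdgeReplace F N) ≤ base x ↔ F.hi e ≤ x := Iff.rfl

@[simp] theorem inner_le_inner {e e' : E} {s t : Interior N} :
    (inner e s : EdgeReplace F N) ≤ inner e' t ↔
      (e = e' ∧ if F.reversed e then t ≤ s else s ≤ t) ∨ F.hi e ≤ F.lo e' := Iff.rfl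

theorem preservesJoinMeet_base : PreservesJoinMeet (base : L → EdgeReplace F N) where
  lub := by
    simp only [isLUB_pair_iff]
    rintro x y z ⟨h1, h2, h3⟩
    refine ⟨h1, h2, ?_⟩
    rintro (w | ⟨e, s⟩)
    · exact h3 w
    · exact h3 (F.lo e)
  glb := by
    simp only [isGLB_pair_iff]
    rintro x y z ⟨h1, h2, h3⟩
    refine ⟨h1, h2, ?_⟩
    rintro (w | ⟨e, s⟩)
    · exact h3 w
    · exact h3 (F.hi e)

variable (F) in
open Classical in
/-- The canonical map of `N` onto the copy at `e`. It is order reversing if `e` is marked. -/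
noncomputable def copy (e : E) (x : N) : EdgeReplace F N :=
  if h : x ≠ ⊥ ∧ x ≠ ⊤ then inner e ⟨x, h⟩
  else if x = ⊥ then base (if F.reversed e then F.hi e else F.lo e)
  else base (if F.reversed e then F.lo e else F.hi e)

theorem copy_coe (e : E) (s : Interior N) : copy F e (s : N) = inner e s := dif_pos s.2

theorem copy_bot (e : E) :
    copy F e (⊥ : N) = base (if F.reversed e then F.hi e else F.lo e) := by
  simp [copy]

theorem copy_top [Nontrivial N] (e : E) :
    copy F e (⊤ : N) = base (if F.reversed e then F.lo e else F.hi e) := by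
  simp [copy]

theorem exists_copy_eq_base [Nontrivial N] (e : E) (x : N) :
    (∃ s, copy F e x = inner e s) ∨ copy F e x = base (F.lo e) ∨ copy F e x = base (F.hi e) := by
  by_cases h : x ≠ ⊥ ∧ x ≠ ⊤
  · exact Or.inl ⟨⟨x, h⟩, copy_coe e ⟨x, h⟩⟩
  · by_cases h' : x = ⊥
    · subst h'
      rw [copy_bot]
      split_ifs <;> simp
    · obtain rfl : x = ⊤ := by tauto
      rw [copy_top]
      split_ifs <;> simp

theorem copy_le_copy [Nontrivial N] {e : E} {x y : N} :
    copy F e x ≤ copy F e y ↔ if F.reversed e then y ≤ x else x ≤ y := by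
  have h0 := F.lo_lt_hi e
  have h1 := h0.not_ge
  have h2 := bot_ne_top (α := N)
  by_cases hx : x ≠ ⊥ ∧ x ≠ ⊤ <;> by_cases hy : y ≠ ⊥ ∧ y ≠ ⊤
  · have h3 := copy_coe (F := F) e ⟨x, hx⟩
    have h4 := copy_coe (F := F) e ⟨y, hy⟩
    dsimp only at h3 h4
    simp [h3, h4, h1]
  · have h3 := copy_coe (F := F) e ⟨x, hx⟩
    dsimp only at h3
    obtain rfl | rfl : y = ⊥ ∨ y = ⊤ := by tauto
    · rw [h3, copy_bot]
      split_ifs <;> simp [h1, hx.1]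
    · rw [h3, copy_top]
      split_ifs <;> simp [h1, hx.2]
  · have h3 := copy_coe (F := F) e ⟨y, hy⟩
    dsimp only at h3
    obtain rfl | rfl : x = ⊥ ∨ x = ⊤ := by tauto
    · rw [h3, copy_bot]
      split_ifs <;> simp [h1, hy.1]
    · rw [h3, copy_top]
      split_ifs <;> simp [h1, hy.2]
  · obtain rfl | rfl : x = ⊥ ∨ x = ⊤ := by tauto
    all_goals obtain rfl | rfl : y = ⊥ ∨ y = ⊤ := by tauto
    all_goals simp only [copy_bot, copy_top]
    all_goals split_ifs <;> simp [h1, h0.le]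

/-- An upper bound of an interior element that is not in the same copy lies above `hi e`, so joins
of interior elements can be tested inside the copy. -/
theorem inner_isLUB {e : E} {s t : Interior N} {z : EdgeReplace F N}
    (h1 : inner e s ≤ z) (h2 : inner e t ≤ z) (h3 : z ≤ base (F.hi e))
    (h4 : ∀ r : Interior N, (inner e s : EdgeReplace F N) ≤ inner e r →
      (inner e t : EdgeReplace F N) ≤ inner e r → z ≤ inner e r) :
    IsLUB {(inner e s : EdgeReplace F N), inner e t} z := by
  refine isLUB_pair_iff.2 ⟨h1, h2, ?_⟩
  rintro (w | ⟨e', r⟩) hs ht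
  · exact h3.trans hs
  · by_cases he : F.hi e ≤ F.lo e'
    · exact h3.trans he
    · obtain rfl : e = e' := by
        rw [inner_le_inner] at hs
        tauto
      exact h4 r hs ht

theorem inner_isGLB {e : E} {s t : Interior N} {z : EdgeReplace F N}
    (h1 : z ≤ inner e s) (h2 : z ≤ inner e t) (h3 : base (F.lo e) ≤ z)
    (h4 : ∀ r : Interior N, (inner e r : EdgeReplace F N) ≤ inner e s →
      (inner e r : EdgeReplace F N) ≤ inner e t → inner e r ≤ z) :
    IsGLB {(inner e s : EdgeReplace F N), inner e t} z := by
  refine isGLB_pair_iff.2 ⟨h1, h2, ?_⟩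
  rintro (w | ⟨e', r⟩) hs ht
  · exact le_trans (base_le_base.2 (base_le_inner.1 hs)) h3
  · by_cases he : F.hi e' ≤ F.lo e
    · exact le_trans (inner_le_base.2 he) h3
    · obtain rfl : e' = e := by
        rw [inner_le_inner] at hs
        tauto
      exact h4 r hs ht

theorem lo_le_copy [Nontrivial N] (e : E) (x : N) : base (F.lo e) ≤ copy F e x := by
  by_cases h : F.reversed e
  · have := copy_top (F := F) (N := N) e
    rw [if_pos h] at this
    rw [← this, copy_le_copy, if_pos h]
    exact le_top
  · have := copy_bot (F := F) (N := N) e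
    rw [if_neg h] at this
    rw [← this, copy_le_copy, if_neg h]
    exact bot_le

theorem copy_le_hi [Nontrivial N] (e : E) (x : N) : copy F e x ≤ base (F.hi e) := by
  by_cases h : F.reversed e
  · have := copy_bot (F := F) (N := N) e
    rw [if_pos h] at this
    rw [← this, copy_le_copy, if_pos h]
    exact bot_le
  · have := copy_top (F := F) (N := N) e
    rw [if_neg h] at this
    rw [← this, copy_le_copy, if_neg h]
    exact le_top

theorem exists_copy_eq_lo [Nontrivial N] (e : E) : ∃ x : N, copy F e x = base (F.lo e) := by
  by_cases he : F.reversed e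
  · exact ⟨⊤, by rw [copy_top, if_pos he]⟩
  · exact ⟨⊥, by rw [copy_bot, if_neg he]⟩

theorem exists_copy_eq_hi [Nontrivial N] (e : E) : ∃ x : N, copy F e x = base (F.hi e) := by
  by_cases he : F.reversed e
  · exact ⟨⊥, by rw [copy_bot, if_pos he]⟩
  · exact ⟨⊤, by rw [copy_top, if_neg he]⟩

/-- The copy at an edge is the whole interval between the endpoints of the edge. -/
theorem exists_copy_eq [Nontrivial N] {e : E} (hcov : F.lo e ⋖ F.hi e)
    (huniq : ∀ e', F.lo e ≤ F.lo e' → F.hi e' ≤ F.hi e → e' = e) {z : EdgeReplace F N}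
    (h1 : base (F.lo e) ≤ z) (h2 : z ≤ base (F.hi e)) : ∃ x, copy F e x = z := by
  obtain z | ⟨e', s⟩ := z
  · rcases hcov.eq_or_eq (base_le_base.1 h1) (base_le_base.1 h2) with rfl | rfl
    · exact exists_copy_eq_lo e
    · exact exists_copy_eq_hi e
  · obtain rfl := huniq e' (base_le_inner.1 h1) (inner_le_base.1 h2)
    exact ⟨s, copy_coe e' s⟩

theorem copy_isLUB [Nontrivial N] {e : E} {x y z : N}
    (h : if F.reversed e then IsGLB {x, y} z else IsLUB {x, y} z) :
    IsLUB {copy F e x, copy F e y} (copy F e z) := by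
  have hx : copy F e x ≤ copy F e z := by
    rw [copy_le_copy]
    split_ifs at h ⊢
    exacts [(isGLB_pair_iff.1 h).1, (isLUB_pair_iff.1 h).1]
  have hy : copy F e y ≤ copy F e z := by
    rw [copy_le_copy]
    split_ifs at h ⊢
    exacts [(isGLB_pair_iff.1 h).2.1, (isLUB_pair_iff.1 h).2.1]
  have key : ∀ t, copy F e x ≤ copy F e t → copy F e y ≤ copy F e t →
      copy F e z ≤ copy F e t := by
    intro t
    simp only [copy_le_copy]
    split_ifs at h ⊢
    exacts [(isGLB_pair_iff.1 h).2.2 t, (isLUB_pair_iff.1 h).2.2 t]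
  -- Once one of the two elements is an endpoint of the edge, they are comparable; only two interior
  -- elements need `inner_isLUB`.
  have trivial1 : copy F e x ≤ copy F e y → IsLUB {copy F e x, copy F e y} (copy F e z) :=
    fun hxy => isLUB_pair_iff.2 ⟨hx, hy, fun w _ h2 => (key y hxy le_rfl).trans h2⟩
  have trivial2 : copy F e y ≤ copy F e x → IsLUB {copy F e x, copy F e y} (copy F e z) :=
    fun hxy => isLUB_pair_iff.2 ⟨hx, hy, fun w h1 _ => (key x le_rfl hxy).trans h1⟩
  obtain ⟨s, hs⟩ | hs | hs := exists_copy_eq_base (F := F) e x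
  · obtain ⟨t, ht⟩ | ht | ht := exists_copy_eq_base (F := F) e y
    · simp only [hs, ht] at hx hy key ⊢
      refine inner_isLUB hx hy (copy_le_hi e z) fun r => ?_
      simpa only [copy_coe] using key r
    · exact trivial2 (ht ▸ lo_le_copy e x)
    · exact trivial1 (ht ▸ copy_le_hi e x)
  · exact trivial1 (hs ▸ lo_le_copy e y)
  · exact trivial2 (hs ▸ copy_le_hi e y)

theorem copy_isGLB [Nontrivial N] {e : E} {x y z : N}
    (h : if F.reversed e then IsLUB {x, y} z else IsGLB {x, y} z) :
    IsGLB {copy F e x, copy F e y} (copy F e z) := by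
  have hx : copy F e z ≤ copy F e x := by
    rw [copy_le_copy]
    split_ifs at h ⊢
    exacts [(isLUB_pair_iff.1 h).1, (isGLB_pair_iff.1 h).1]
  have hy : copy F e z ≤ copy F e y := by
    rw [copy_le_copy]
    split_ifs at h ⊢
    exacts [(isLUB_pair_iff.1 h).2.1, (isGLB_pair_iff.1 h).2.1]
  have key : ∀ t, copy F e t ≤ copy F e x → copy F e t ≤ copy F e y →
      copy F e t ≤ copy F e z := by
    intro t
    simp only [copy_le_copy]
    split_ifs at h ⊢
    exacts [(isLUB_pair_iff.1 h).2.2 t, (isGLB_pair_iff.1 h).2.2 t]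
  have trivial1 : copy F e x ≤ copy F e y → IsGLB {copy F e x, copy F e y} (copy F e z) :=
    fun hxy => isGLB_pair_iff.2 ⟨hx, hy, fun w h1 _ => h1.trans (key x le_rfl hxy)⟩
  have trivial2 : copy F e y ≤ copy F e x → IsGLB {copy F e x, copy F e y} (copy F e z) :=
    fun hxy => isGLB_pair_iff.2 ⟨hx, hy, fun w _ h2 => h2.trans (key y hxy le_rfl)⟩
  obtain ⟨s, hs⟩ | hs | hs := exists_copy_eq_base (F := F) e x
  · obtain ⟨t, ht⟩ | ht | ht := exists_copy_eq_base (F := F) e y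
    · simp only [hs, ht] at hx hy key ⊢
      refine inner_isGLB hx hy (lo_le_copy e z) fun r => ?_
      simpa only [copy_coe] using key r
    · exact trivial2 (ht ▸ lo_le_copy e x)
    · exact trivial1 (ht ▸ copy_le_hi e x)
  · exact trivial1 (hs ▸ lo_le_copy e y)
  · exact trivial2 (hs ▸ copy_le_hi e y)

/-- No interior element of the copy at `e` is above `x`, so the common upper bounds of `x` and `s`
are those of `x` and `hi e`. -/
theorem isLUB_base_inner {x y : L} {e : E} {s : Interior N} (h1 : ¬ x ≤ F.lo e)
    (hy : IsLUB {x, F.hi e} y) :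
    IsLUB {base x, (inner e s : EdgeReplace F N)} (base y) := by
  rw [isLUB_pair_iff] at hy ⊢
  refine ⟨hy.1, hy.2.1, ?_⟩
  rintro (w | ⟨e', r⟩)
  · exact hy.2.2 w
  · simp only [base_le_inner, inner_le_inner]
    rintro h2 (⟨rfl, -⟩ | h3)
    · exact (h1 h2).elim
    · exact hy.2.2 _ h2 h3

theorem isGLB_base_inner {x y : L} {e : E} {s : Interior N} (h1 : ¬ F.hi e ≤ x)
    (hy : IsGLB {x, F.lo e} y) :
    IsGLB {base x, (inner e s : EdgeReplace F N)} (base y) := by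
  rw [isGLB_pair_iff] at hy ⊢
  refine ⟨hy.1, hy.2.1, ?_⟩
  rintro (w | ⟨e', r⟩)
  · exact hy.2.2 w
  · simp only [inner_le_base, inner_le_inner]
    rintro h2 (⟨rfl, -⟩ | h3)
    · exact (h1 h2).elim
    · exact hy.2.2 _ h2 h3

theorem exists_isLUB [Nontrivial N] (hL : ∀ x y : L, ∃ z, IsLUB {x, y} z)
    (hN : ∀ x y : N, ∃ z, IsLUB {x, y} z) (hN' : ∀ x y : N, ∃ z, IsGLB {x, y} z)
    (x y : EdgeReplace F N) : ∃ z, IsLUB {x, y} z := by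
  have mixed : ∀ x e s, ∃ z, IsLUB {base x, (inner e s : EdgeReplace F N)} z := by
    intro x e s
    by_cases h1 : x ≤ F.lo e
    · exact ⟨_, isLUB_pair_of_le (base_le_inner.2 h1)⟩
    · obtain ⟨z, hz⟩ := hL x (F.hi e)
      exact ⟨_, isLUB_base_inner h1 hz⟩
  obtain x | ⟨e, s⟩ := x <;> obtain y | ⟨e', t⟩ := y
  · obtain ⟨z, hz⟩ := hL x y
    exact ⟨_, preservesJoinMeet_base.lub hz⟩
  · exact mixed x e' t
  · rw [Set.pair_comm]
    exact mixed y e s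
  · by_cases he : e = e'
    · subst he
      obtain ⟨z, hz⟩ : ∃ z : N, if F.reversed e then IsGLB {(s : N), (t : N)} z
          else IsLUB {(s : N), (t : N)} z := by
        split_ifs
        exacts [hN' s t, hN s t]
      refine ⟨copy F e z, ?_⟩
      rw [← copy_coe, ← copy_coe]
      exact copy_isLUB hz
    · by_cases h1 : F.hi e ≤ F.lo e'
      · exact ⟨_, isLUB_pair_of_le (inner_le_inner.2 (Or.inr h1))⟩
      by_cases h2 : F.hi e' ≤ F.lo e
      · exact ⟨_, isLUB_pair_of_ge (inner_le_inner.2 (Or.inr h2))⟩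
      obtain ⟨z, hz⟩ := hL (F.hi e) (F.hi e')
      refine ⟨base z, ?_⟩
      rw [isLUB_pair_iff] at hz ⊢
      refine ⟨hz.1, hz.2.1, ?_⟩
      rintro (w | ⟨e'', r⟩)
      · exact hz.2.2 w
      · simp only [inner_le_inner, base_le_inner]
        rintro (⟨rfl, -⟩ | h3) (⟨rfl, -⟩ | h4)
        · exact (he rfl).elim
        · exact (h2 h4).elim
        · exact (h1 h3).elim
        · exact hz.2.2 _ h3 h4

theorem exists_isGLB [Nontrivial N] (hL : ∀ x y : L, ∃ z, IsGLB {x, y} z)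
    (hN : ∀ x y : N, ∃ z, IsLUB {x, y} z) (hN' : ∀ x y : N, ∃ z, IsGLB {x, y} z)
    (x y : EdgeReplace F N) : ∃ z, IsGLB {x, y} z := by
  have mixed : ∀ x e s, ∃ z, IsGLB {base x, (inner e s : EdgeReplace F N)} z := by
    intro x e s
    by_cases h1 : F.hi e ≤ x
    · exact ⟨_, isGLB_pair_of_ge (inner_le_base.2 h1)⟩
    · obtain ⟨z, hz⟩ := hL x (F.lo e)
      exact ⟨_, isGLB_base_inner h1 hz⟩
  obtain x | ⟨e, s⟩ := x <;> obtain y | ⟨e', t⟩ := y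
  · obtain ⟨z, hz⟩ := hL x y
    exact ⟨_, preservesJoinMeet_base.glb hz⟩
  · exact mixed x e' t
  · rw [Set.pair_comm]
    exact mixed y e s
  · by_cases he : e = e'
    · subst he
      obtain ⟨z, hz⟩ : ∃ z : N, if F.reversed e then IsLUB {(s : N), (t : N)} z
          else IsGLB {(s : N), (t : N)} z := by
        split_ifs
        exacts [hN s t, hN' s t]
      refine ⟨copy F e z, ?_⟩
      rw [← copy_coe, ← copy_coe]
      exact copy_isGLB hz
    · by_cases h1 : F.hi e' ≤ F.lo e
      · exact ⟨_, isGLB_pair_of_ge (inner_le_inner.2 (Or.inr h1))⟩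
      by_cases h2 : F.hi e ≤ F.lo e'
      · exact ⟨_, isGLB_pair_of_le (inner_le_inner.2 (Or.inr h2))⟩
      obtain ⟨z, hz⟩ := hL (F.lo e) (F.lo e')
      refine ⟨base z, ?_⟩
      rw [isGLB_pair_iff] at hz ⊢
      refine ⟨hz.1, hz.2.1, ?_⟩
      rintro (w | ⟨e'', r⟩)
      · exact hz.2.2 w
      · simp only [inner_le_inner, inner_le_base]
        rintro (⟨rfl, -⟩ | h3) (⟨rfl, -⟩ | h4)
        · exact (he rfl).elim
        · exact (h2 h4).elim
        · exact (h1 h3).elim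
        · exact hz.2.2 _ h3 h4

/-- Replacing edges of a simple lattice with copies of a simple lattice and of its dual yields a
simple lattice. -/
theorem isSimpleOrderedSet [BoundedOrder L] (hL : IsSimpleOrderedSet L)
    (hN : IsSimpleOrderedSet N) : IsSimpleOrderedSet (EdgeReplace F N) := by
  have := hN.nontrivial
  have hlub := exists_isLUB (F := F) hL.exists_isLUB hN.exists_isLUB hN.exists_isGLB
  have hglb := exists_isGLB (F := F) hL.exists_isGLB hN.exists_isLUB hN.exists_isGLB
  refine ⟨hlub, hglb, ?_, fun r hr => ?_⟩
  · obtain ⟨x, y, hxy⟩ := hL.nontrivial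
    exact ⟨base x, base y, fun h => hxy (by injection h)⟩
  -- On a reversed edge `copy` exchanges joins and meets, which is harmless as the notion of
  -- congruence is selfdual.
  have hcopy : ∀ e, (∀ x y, r (copy F e x) (copy F e y) → x = y) ∨
      ∀ x y, r (copy F e x) (copy F e y) := fun e => by
    refine hN.eq_or_full _ ⟨⟨fun _ => hr.equiv.refl _, fun h => hr.equiv.symm h,
      fun h h' => hr.equiv.trans h h'⟩, ?_, ?_⟩
    · intro x y z s t h hs ht
      by_cases he : F.reversed e
      · exact hr.glb h (copy_isGLB (by rwa [if_pos he])) (copy_isGLB (by rwa [if_pos he]))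
      · exact hr.lub h (copy_isLUB (by rwa [if_neg he])) (copy_isLUB (by rwa [if_neg he]))
    · intro x y z s t h hs ht
      by_cases he : F.reversed e
      · exact hr.lub h (copy_isLUB (by rwa [if_pos he])) (copy_isLUB (by rwa [if_pos he]))
      · exact hr.glb h (copy_isGLB (by rwa [if_neg he])) (copy_isGLB (by rwa [if_neg he]))
  rcases hL.eq_or_full _ (hr.comap preservesJoinMeet_base) with h1 | h1
  · left
    -- Being full on a copy would collapse the two distinct endpoints of the edge, which lie in `L`.
    have h2 : ∀ e x y, r (copy F e x) (copy F e y) → copy F e x = copy F e y := fun e x y h => by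
      rcases hcopy e with h2 | h2
      · rw [h2 x y h]
      · have h3 := h2 ⊥ ⊤
        rw [copy_bot, copy_top] at h3
        have h4 := h1 _ _ h3
        have h5 := F.lo_lt_hi e
        split_ifs at h4
        · exact (h5.ne' h4).elim
        · exact (h5.ne h4).elim
    have hl : ∀ e s, ¬ r (base (F.lo e)) (inner e s) := fun e s h => by
      obtain ⟨x, hx⟩ := exists_copy_eq_lo (F := F) (N := N) e
      have := h2 e x s (by rwa [hx, copy_coe])
      rw [hx, copy_coe] at this
      cases this
    have hh : ∀ e s, ¬ r (inner e s) (base (F.hi e)) := fun e s h => by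
      obtain ⟨x, hx⟩ := exists_copy_eq_hi (F := F) (N := N) e
      have := h2 e s x (by rwa [hx, copy_coe])
      rw [hx, copy_coe] at this
      cases this
    refine hr.eq_of_not_lt hlub ?_
    rintro (x | ⟨e, s⟩) (y | ⟨e', t⟩) hlt h
    · exact hlt.ne (congrArg _ (h1 _ _ h))
    · exact hl e' t (hr.interval h hlt.le (base_le_inner.2 le_rfl) le_rfl)
    · exact hh e s (hr.interval h le_rfl (inner_le_base.2 le_rfl) hlt.le)
    · by_cases h3 : F.hi e ≤ F.lo e'
      · exact hh e s (hr.interval h le_rfl (inner_le_base.2 le_rfl) (base_le_inner.2 h3))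
      · obtain rfl : e = e' := by
          have := hlt.le
          rw [inner_le_inner] at this
          tauto
        rw [← copy_coe, ← copy_coe] at h hlt
        exact hlt.ne (h2 e (s : N) t h)
  · right
    refine hr.full_of_le ?_ ?_ (h1 ⊥ ⊤)
    · rintro (x | ⟨e, s⟩)
      · exact base_le_base.2 bot_le
      · exact base_le_inner.2 bot_le
    · rintro (x | ⟨e, s⟩)
      · exact base_le_base.2 le_top
      · exact inner_le_base.2 le_top

instance [OrderBot L] : OrderBot (EdgeReplace F N) where
  bot := base ⊥
  bot_le x := by
    cases x with
    | base x => exact base_le_base.2 bot_le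
    | inner e s => exact base_le_inner.2 bot_le

/-- A matching of two edge families that turns everything upside down yields a dual isomorphism
after the replacement of the edges. -/
theorem exists_dualIso {L' : Type*} [PartialOrder L'] {E' : Type*} {F' : EdgeFamily L' E'}
    (f : L ≃o L'ᵒᵈ) (k : E ≃ E') (hlo : ∀ e, f (F.lo e) = OrderDual.toDual (F'.hi (k e)))
    (hhi : ∀ e, f (F.hi e) = OrderDual.toDual (F'.lo (k e)))
    (hrev : ∀ e, F'.reversed (k e) = !F.reversed e) :
    ∃ G : EdgeReplace F N ≃o (EdgeReplace F' N)ᵒᵈ,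
      ∀ x, G (base x) = OrderDual.toDual (base (OrderDual.ofDual (f x))) := by
  let g : EdgeReplace F N → EdgeReplace F' N := fun
    | base x => base (OrderDual.ofDual (f x))
    | inner e s => inner (k e) s
  have hle : ∀ x y, x ≤ y ↔ g y ≤ g x := by
    have h1 : ∀ x y, x ≤ y ↔ OrderDual.ofDual (f y) ≤ OrderDual.ofDual (f x) :=
      fun x y => (f.le_iff_le (x := x) (y := y)).symm
    rintro (x | ⟨e, s⟩) (y | ⟨e', t⟩) <;> simp only [g]
    · exact h1 x y
    · rw [base_le_inner, inner_le_base, h1, hlo, OrderDual.ofDual_toDual]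
    · rw [base_le_inner, inner_le_base, h1, hhi, OrderDual.ofDual_toDual]
    · rw [inner_le_inner, inner_le_inner, h1, hlo, hhi, OrderDual.ofDual_toDual,
        OrderDual.ofDual_toDual, hrev, k.injective.eq_iff]
      refine or_congr_left ⟨?_, ?_⟩
      · rintro ⟨rfl, h⟩
        cases h2 : F.reversed e <;> simp_all
      · rintro ⟨rfl, h⟩
        cases h2 : F.reversed e' <;> simp_all
  obtain ⟨G, hG⟩ := exists_orderIso_of_surjective (X := EdgeReplace F N)
    (Y := (EdgeReplace F' N)ᵒᵈ) (π := id) (ρ := OrderDual.toDual) (s := g)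
    Function.surjective_id OrderDual.toDual.surjective
    (by
      rintro (y | ⟨e, s⟩)
      · exact ⟨base (f.symm (OrderDual.toDual y)), by simp [g]⟩
      · exact ⟨inner (k.symm e) s, by simp [g]⟩) hle
  exact ⟨G, fun x => hG (base x)⟩

end EdgeReplace

/-! ### Frucht lattices of complete graphs -/

namespace FruchtT

variable {I : Type u} [LinearOrder I]

@[simp] theorem atom_le_atom {i j : I} : atom i ≤ atom j ↔ i = j := Iff.rfl

@[simp] theorem atom_le_coatom {i j k : I} {h : i < j} :
    atom k ≤ coatom i j h ↔ k = i ∨ k = j := Iff.rfl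

@[simp] theorem coatom_le_coatom {i j k l : I} {h : i < j} {h' : k < l} :
    coatom i j h ≤ coatom k l h' ↔ i = k ∧ j = l := Iff.rfl

@[simp] theorem not_coatom_le_atom {i j k : I} {h : i < j} : ¬ coatom i j h ≤ atom k := id

@[simp] theorem not_atom_le_bot {i : I} : ¬ atom i ≤ ⊥ := id

@[simp] theorem not_top_le_atom {i : I} : ¬ ⊤ ≤ atom i := id

@[simp] theorem not_top_le_coatom {i j : I} {h : i < j} : ¬ ⊤ ≤ coatom i j h := id

@[simp] theorem not_top_le_bot : ¬ (⊤ : FruchtT I) ≤ ⊥ := id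

@[simp] theorem atom_ne_bot {i : I} : atom i ≠ ⊥ := nofun

@[simp] theorem coatom_ne_bot {i j : I} {h : i < j} : coatom i j h ≠ ⊥ := nofun

theorem isAtom_atom (i : I) : IsAtom (atom i) := by
  refine ⟨nofun, ?_⟩
  rintro (_ | _ | j | ⟨j, k, h⟩) hlt
  · rfl
  · exact (not_top_le_atom hlt.le).elim
  · exact (hlt.ne (congrArg _ (atom_le_atom.1 hlt.le))).elim
  · exact (not_coatom_le_atom hlt.le).elim

/-- The coatom of an unordered pair of vertices. -/
def edge (i j : I) (h : i ≠ j) : FruchtT I :=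
  if h' : i < j then coatom i j h' else coatom j i (lt_of_le_of_ne (not_lt.1 h') h.symm)

theorem coatom_eq_edge (i j : I) (h : i < j) : coatom i j h = edge i j h.ne := by
  simp [edge, h]

theorem atom_le_edge {i j k : I} {h : i ≠ j} : atom k ≤ edge i j h ↔ k = i ∨ k = j := by
  unfold edge
  split_ifs <;> simp [or_comm]

theorem eq_cases (x : FruchtT I) :
    x = ⊥ ∨ x = ⊤ ∨ (∃ i, x = atom i) ∨ ∃ i j h, x = edge i j h := by
  rcases x with _ | _ | i | ⟨i, j, h⟩
  · exact Or.inl rfl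
  · exact Or.inr (Or.inl rfl)
  · exact Or.inr (Or.inr (Or.inl ⟨i, rfl⟩))
  · exact Or.inr (Or.inr (Or.inr ⟨i, j, h.ne, coatom_eq_edge i j h⟩))

theorem not_edge_le_atom {i j k : I} {h : i ≠ j} : ¬ edge i j h ≤ atom k := by
  unfold edge
  split_ifs <;> simp

theorem not_edge_le_bot {i j : I} {h : i ≠ j} : ¬ edge i j h ≤ ⊥ := by
  unfold edge
  split_ifs <;> simp

theorem not_top_le_edge {i j : I} {h : i ≠ j} : ¬ ⊤ ≤ edge i j h := by
  unfold edge
  split_ifs <;> simp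

theorem isLUB_edge (i j : I) (h : i ≠ j) : IsLUB {atom i, atom j} (edge i j h) := by
  refine isLUB_pair_iff.2 ⟨atom_le_edge.2 (Or.inl rfl), atom_le_edge.2 (Or.inr rfl), ?_⟩
  rintro (_ | _ | k | ⟨k, l, hkl⟩) h1 h2
  · exact h1.elim
  · exact le_top
  · exact (h ((atom_le_atom.1 h1).trans (atom_le_atom.1 h2).symm)).elim
  · rw [atom_le_coatom] at h1 h2
    unfold edge
    split_ifs with h3 <;> rw [coatom_le_coatom]
    · rcases h1 with rfl | rfl <;> rcases h2 with rfl | rfl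
      · exact (h rfl).elim
      · exact ⟨rfl, rfl⟩
      · exact (h3.not_gt hkl).elim
      · exact (h rfl).elim
    · rcases h1 with rfl | rfl <;> rcases h2 with rfl | rfl
      · exact (h rfl).elim
      · exact (h3 hkl).elim
      · exact ⟨rfl, rfl⟩
      · exact (h rfl).elim

theorem edge_le_iff {i j : I} {h : i ≠ j} {x : FruchtT I} :
    edge i j h ≤ x ↔ atom i ≤ x ∧ atom j ≤ x := by
  obtain ⟨h1, h2, h3⟩ := isLUB_pair_iff.1 (isLUB_edge i j h)
  exact ⟨fun h => ⟨h1.trans h, h2.trans h⟩, fun h => h3 x h.1 h.2⟩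

theorem edge_le_edge {i j k l : I} {h : i ≠ j} {h' : k ≠ l} :
    edge i j h ≤ edge k l h' ↔ (i = k ∨ i = l) ∧ (j = k ∨ j = l) := by
  rw [edge_le_iff, atom_le_edge, atom_le_edge]

theorem eq_of_edge_le {i j : I} {h : i ≠ j} {x : FruchtT I} (hx : edge i j h ≤ x) :
    x = edge i j h ∨ x = ⊤ := by
  obtain rfl | rfl | ⟨k, rfl⟩ | ⟨k, l, hkl, rfl⟩ := eq_cases x
  · exact (not_edge_le_bot hx).elim
  · exact Or.inr rfl
  · exact (not_edge_le_atom hx).elim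
  · left
    refine le_antisymm ?_ hx
    rw [edge_le_edge] at hx ⊢
    grind

theorem isLUB_edge_atom {i j k : I} (h : i ≠ j) (hi : k ≠ i) (hj : k ≠ j) :
    IsLUB {edge i j h, atom k} ⊤ := by
  refine isLUB_pair_iff.2 ⟨le_top, le_top, fun w h1 h2 => ?_⟩
  rcases eq_of_edge_le h1 with rfl | rfl
  · rw [atom_le_edge] at h2
    tauto
  · exact le_rfl

theorem isGLB_atom {i : I} {x : FruchtT I} (h : ¬ atom i ≤ x) : IsGLB {atom i, x} ⊥ := by
  refine isGLB_pair_iff.2 ⟨bot_le, bot_le, fun w h1 h2 => ?_⟩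
  rcases (isAtom_atom i).le_iff.1 h1 with rfl | rfl
  · exact le_rfl
  · exact (h h2).elim

theorem exists_isLUB (x y : FruchtT I) : ∃ z, IsLUB {x, y} z := by
  by_cases h1 : x ≤ y
  · exact ⟨_, isLUB_pair_of_le h1⟩
  by_cases h2 : y ≤ x
  · exact ⟨_, isLUB_pair_of_ge h2⟩
  obtain rfl | rfl | ⟨i, rfl⟩ | ⟨i, j, h, rfl⟩ := eq_cases x
  · exact (h1 bot_le).elim
  · exact (h2 le_top).elim
  · obtain rfl | rfl | ⟨j, rfl⟩ | ⟨j, k, h, rfl⟩ := eq_cases y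
    · exact (h2 bot_le).elim
    · exact (h1 le_top).elim
    · exact ⟨_, isLUB_edge i j h1⟩
    · rw [atom_le_edge, not_or] at h1
      exact ⟨⊤, Set.pair_comm _ _ ▸ isLUB_edge_atom h h1.1 h1.2⟩
  · refine ⟨⊤, isLUB_pair_iff.2 ⟨le_top, le_top, fun w h3 h4 => ?_⟩⟩
    rcases eq_of_edge_le h3 with rfl | rfl
    · exact (h2 h4).elim
    · exact le_rfl

/-- On at least three vertices, the order is determined by the atoms. -/
theorem le_iff_atom_le [Nonempty I] (hI : ∀ i j : I, ∃ k, k ≠ i ∧ k ≠ j) {x y : FruchtT I} :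
    x ≤ y ↔ ∀ i, atom i ≤ x → atom i ≤ y := by
  refine ⟨fun h i hi => hi.trans h, fun h => ?_⟩
  obtain rfl | rfl | ⟨i, rfl⟩ | ⟨i, j, hij, rfl⟩ := eq_cases x
  · exact bot_le
  · obtain rfl | rfl | ⟨j, rfl⟩ | ⟨j, k, hjk, rfl⟩ := eq_cases y
    · exact (not_atom_le_bot (h (Classical.arbitrary I) le_top)).elim
    · exact le_rfl
    · obtain ⟨k, hk, -⟩ := hI j j
      exact (hk (h k le_top)).elim
    · obtain ⟨l, hl, hl'⟩ := hI j k
      exact (not_or_intro hl hl' (atom_le_edge.1 (h l le_top))).elim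
  · exact h i le_rfl
  · exact edge_le_iff.2 ⟨h i (edge_le_iff.1 le_rfl).1, h j (edge_le_iff.1 le_rfl).2⟩

theorem exists_isGLB [Nonempty I] (hI : ∀ i j : I, ∃ k, k ≠ i ∧ k ≠ j) (x y : FruchtT I) :
    ∃ z, IsGLB {x, y} z := by
  by_cases h1 : x ≤ y
  · exact ⟨_, isGLB_pair_of_le h1⟩
  by_cases h2 : y ≤ x
  · exact ⟨_, isGLB_pair_of_ge h2⟩
  by_cases h3 : ∃ i, atom i ≤ x ∧ atom i ≤ y
  · obtain ⟨i, hx, hy⟩ := h3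
    refine ⟨atom i, isGLB_pair_iff.2 ⟨hx, hy, fun w h4 h5 => ?_⟩⟩
    rw [le_iff_atom_le hI]
    intro j hj
    by_contra hji
    rw [atom_le_atom] at hji
    have ex : edge j i hji ≤ x := edge_le_iff.2 ⟨hj.trans h4, hx⟩
    have ey : edge j i hji ≤ y := edge_le_iff.2 ⟨hj.trans h5, hy⟩
    rcases eq_of_edge_le ex with rfl | rfl
    · exact h1 ey
    · exact h2 le_top
  · push Not at h3
    refine ⟨⊥, isGLB_pair_iff.2 ⟨bot_le, bot_le, fun w h4 h5 => ?_⟩⟩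
    rw [le_iff_atom_le hI]
    exact fun i hi => (h3 i (hi.trans h4) (hi.trans h5)).elim

/-- Suppose `⊥` and `g_i` are collapsed. Joining with `g_j` and then with `g_k` collapses `g^{jk}`
with `⊤`; meeting with `g_l`, where `l ∉ {j, k}`, collapses `⊥` with `g_l`. So all atoms collapse
with `⊥`, and then everything does. Any collapsed pair `u < v` leads to this situation by a meet
with an atom below `v` but not below `u`. Four vertices give enough room. -/
theorem isSimpleOrderedSet [Nonempty I] (hI : ∀ i j k : I, ∃ l, l ≠ i ∧ l ≠ j ∧ l ≠ k) :
    IsSimpleOrderedSet (FruchtT I) where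
  exists_isLUB := exists_isLUB
  exists_isGLB := exists_isGLB fun i j => (hI i j j).imp fun _ h => ⟨h.1, h.2.1⟩
  nontrivial := ⟨bot, top, nofun⟩
  eq_or_full r hr := by
    have join : ∀ {i} j (h : i ≠ j), r ⊥ (atom i) → r (atom j) (edge i j h) := fun j h hi =>
      hr.lub hi (isLUB_pair_of_le bot_le) (isLUB_edge _ j h)
    have all : ∀ i, r ⊥ (atom i) → ∀ l, r ⊥ (atom l) := by
      intro i h l
      obtain ⟨j, hji, hjl, -⟩ := hI i l l
      obtain ⟨k, hki, hkj, hkl⟩ := hI i j l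
      have h2 := hr.lub (join j hji.symm h) (isLUB_edge j k hkj.symm)
        (isLUB_edge_atom hji.symm hki hkj)
      have h3 : IsGLB {edge j k hkj.symm, atom l} ⊥ := by
        rw [Set.pair_comm]
        refine isGLB_atom ?_
        rw [atom_le_edge]
        grind
      exact hr.glb h2 h3 (isGLB_pair_of_ge le_top)
    have full : ∀ i, r ⊥ (atom i) → ∀ x y, r x y := by
      intro i h
      obtain ⟨j, hji, -, -⟩ := hI i i i
      obtain ⟨k, hki, hkj, -⟩ := hI i j j
      have h1 := hr.equiv.trans (all i h j) (join j hji.symm h)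
      have h2 := hr.lub h1 (isLUB_pair_of_le bot_le) (isLUB_edge_atom hji.symm hki hkj)
      exact hr.full_of_le (fun _ => bot_le) (fun _ => le_top) (hr.equiv.trans (all i h k) h2)
    by_contra hc
    push Not at hc
    obtain ⟨⟨x, y, hxy, hne⟩, p, q, hpq⟩ := hc
    have none : ∀ i, ¬ r ⊥ (atom i) := fun i h => hpq (full i h p q)
    refine hne (hr.eq_of_not_lt exists_isLUB ?_ x y hxy)
    intro u v huv h
    obtain ⟨i, hi, hi'⟩ : ∃ i, atom i ≤ v ∧ ¬ atom i ≤ u := by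
      have h1 := huv.not_ge
      rw [le_iff_atom_le fun i j => (hI i j j).imp fun _ h => ⟨h.1, h.2.1⟩] at h1
      push Not at h1
      exact h1
    refine none i (hr.glb h ?_ (isGLB_pair_of_ge hi))
    rw [Set.pair_comm]
    exact isGLB_atom hi'

end FruchtT

/-! ### The order of `S_0(α)` -/

namespace Glue

variable {A : Type u} {B : Type v} [PartialOrder A] [PartialOrder B] [OrderBot B] {c : A} {g : B}

/-- The top of a gluing. -/
noncomputable abbrev orderTop [OrderTop A] [OrderTop B] (hc : IsCoatom c) (hg : IsAtom g) :
    OrderTop (Glue A B c g) where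
  top := ofUpper ⊤
  le_top x := by
    obtain ⟨x, rfl⟩ | ⟨x, rfl⟩ := exists_eq x
    · exact (lower_le_ofUpper hg).2 (Or.inr le_top)
    · exact (ofUpper_le_ofUpper hc hg).2 le_top

end Glue

theorem IsConnector.exists_chain {M : Type} [PartialOrder M] [BoundedOrder M] {a c : M}
    (hM : IsConnector M a c) : ∃ x y z : M, ⊥ < x ∧ x < y ∧ y < z ∧ z < ⊤ := by
  have h : ((4 : ℕ) : WithBot ℕ∞) ≤ Order.krullDim M := hM.length.ge
  obtain ⟨l, hl⟩ := Order.le_krullDim_iff.1 h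
  have hlt : ∀ i j : Fin (l.length + 1), i < j → l i < l j := fun i j h => l.strictMono h
  refine ⟨l ⟨1, by omega⟩, l ⟨2, by omega⟩, l ⟨3, by omega⟩,
    bot_le.trans_lt (hlt ⟨0, by omega⟩ _ ?_), hlt _ _ ?_, hlt _ _ ?_,
    (hlt _ ⟨4, by omega⟩ ?_).trans_le le_top⟩ <;> simp [Fin.lt_def]

theorem IsEdgeFiller.exists_chain {N : Type} [PartialOrder N] [BoundedOrder N]
    (hN : IsEdgeFiller N) : ∃ x y : N, ⊥ < x ∧ x < y ∧ y < ⊤ := by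
  have h : ((3 : ℕ) : WithBot ℕ∞) ≤ Order.krullDim N := hN.length.ge
  obtain ⟨l, hl⟩ := Order.le_krullDim_iff.1 h
  have hlt : ∀ i j : Fin (l.length + 1), i < j → l i < l j := fun i j h => l.strictMono h
  refine ⟨l ⟨1, by omega⟩, l ⟨2, by omega⟩,
    bot_le.trans_lt (hlt ⟨0, by omega⟩ _ ?_), hlt _ _ ?_,
    (hlt _ ⟨3, by omega⟩ ?_).trans_le le_top⟩ <;> simp [Fin.lt_def]

namespace IsConnector

variable {M : Type} [PartialOrder M] [BoundedOrder M] {a c : M}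

theorem coatom_ne_bot (hM : IsConnector M a c) : c ≠ ⊥ := by
  rintro rfl
  obtain ⟨x, y, z, h1, h2, -⟩ := hM.exists_chain
  have := hM.coatom.2 x h1
  exact (this ▸ h2).not_ge le_top

theorem atom_ne_top (hM : IsConnector M a c) : a ≠ ⊤ := by
  rintro rfl
  obtain ⟨x, y, z, -, h1, h2, h3⟩ := hM.exists_chain
  have := hM.atom.2 z h3
  exact (this ▸ h2).not_ge bot_le

end IsConnector

theorem Idx.exists_notMem {α : Ordinal.{u}} (s : Finset (Idx α)) (hs : s.card < 6) :
    ∃ i, i ∉ s := by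
  by_contra! h
  let f : Fin 6 → Idx α := fun n => ⟨((n : ℕ) : Ordinal.{u}),
    lt_of_lt_of_le (by exact_mod_cast n.2) (le_self_add : (6 : Ordinal.{u}) ≤ 6 + α)⟩
  have hf : f.Injective := fun m n h => by
    have h1 : ((m : ℕ) : Ordinal.{u}) = (n : ℕ) := congrArg Subtype.val h
    exact Fin.ext (Nat.cast_injective h1)
  have h1 := Finset.card_le_card_of_injOn (s := Finset.univ) (t := s) f (fun i _ => h _) hf.injOn
  simp at h1
  omega

theorem Idx.exists_ne {α : Ordinal.{u}} (i j k : Idx α) : ∃ l, l ≠ i ∧ l ≠ j ∧ l ≠ k := by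
  obtain ⟨l, hl⟩ := Idx.exists_notMem {i, j, k}
    (lt_of_le_of_lt Finset.card_le_three (by norm_num))
  simp only [Finset.mem_insert, Finset.mem_singleton, not_or] at hl
  exact ⟨l, hl⟩

instance (α : Ordinal.{u}) : Nonempty (Idx α) := ⟨idxZero α⟩

namespace S0

variable {M : Type} [PartialOrder M] [BoundedOrder M] {a c : M} {α : Ordinal.{u}}

variable (M a c α) in
/-- The canonical map of `M` into `S_0(α)`. -/
noncomputable def mid (m : M) : S0 M a c α :=
  Glue.ofUpper (Glue.lower m)

theorem isAtom_lower (hM : IsConnector M a c) : IsAtom (Glue.lower a : UpperPart M c α) := by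
  refine ⟨fun h => hM.atom.1 (by injection h), ?_⟩
  rintro (x | ⟨x, hx⟩) h
  · exact congrArg _ (hM.atom.2 x (lt_of_le_of_ne h.le fun h' => h.ne (congrArg _ h')))
  · exact (Glue.not_upper_le_lower h.le).elim

theorem isCoatom_dual :
    IsCoatom (OrderDual.toDual (FruchtT.atom (idxZero α)) : (TLat α)ᵒᵈ) :=
  (FruchtT.isAtom_atom (idxZero α)).dual

theorem down_le_down {x y : TLat α} : down M a c α x ≤ down M a c α y ↔ y ≤ x := Iff.rfl

theorem down_le_mid (hM : IsConnector M a c) {x : TLat α} {m : M} :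
    down M a c α x ≤ mid M a c α m ↔ FruchtT.atom (idxZero α) ≤ x ∨ a ≤ m :=
  Glue.lower_le_ofUpper (isAtom_lower hM)

theorem mid_le_down (hM : IsConnector M a c) {x : TLat α} {m : M} :
    mid M a c α m ≤ down M a c α x ↔
      m = ⊥ ∧ x ≤ FruchtT.atom (idxZero α) ∨ m ≤ a ∧ x = ⊥ := by
  refine (Glue.ofUpper_le_lower (isAtom_lower hM)).trans
    (or_congr (and_congr_left fun _ => ⟨fun h => ?_, fun h => congrArg _ h⟩) Iff.rfl)
  injection h

theorem mid_le_mid (hM : IsConnector M a c) {m n : M} :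
    mid M a c α m ≤ mid M a c α n ↔ m ≤ n :=
  Glue.ofUpper_le_ofUpper isCoatom_dual (isAtom_lower hM)

theorem mid_le_up (hM : IsConnector M a c) {x : TLat α} {m : M} :
    mid M a c α m ≤ up M a c α x ↔ m ≤ c ∨ FruchtT.atom (idxZero α) ≤ x :=
  (Glue.ofUpper_le_ofUpper isCoatom_dual (isAtom_lower hM)).trans
    (Glue.lower_le_ofUpper (FruchtT.isAtom_atom _))

theorem up_le_mid (hM : IsConnector M a c) {x : TLat α} {m : M} :
    up M a c α x ≤ mid M a c α m ↔
      x = ⊥ ∧ c ≤ m ∨ x ≤ FruchtT.atom (idxZero α) ∧ m = ⊤ :=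
  (Glue.ofUpper_le_ofUpper isCoatom_dual (isAtom_lower hM)).trans
    (Glue.ofUpper_le_lower (FruchtT.isAtom_atom _))

theorem up_le_up (hM : IsConnector M a c) {x y : TLat α} :
    up M a c α x ≤ up M a c α y ↔ x ≤ y :=
  (Glue.ofUpper_le_ofUpper isCoatom_dual (isAtom_lower hM)).trans
    (Glue.ofUpper_le_ofUpper hM.coatom (FruchtT.isAtom_atom _))

theorem down_le_up (hM : IsConnector M a c) {x y : TLat α} :
    down M a c α x ≤ up M a c α y ↔
      FruchtT.atom (idxZero α) ≤ x ∨ a ≤ c ∨ FruchtT.atom (idxZero α) ≤ y :=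
  (Glue.lower_le_ofUpper (isAtom_lower hM)).trans
    (or_congr Iff.rfl (Glue.lower_le_ofUpper (FruchtT.isAtom_atom _)))

/-- Since `up ⊥` is `c` and `down ⊥` is `a`, the only comparison left is `c ≤ a`, a case that is
carried along rather than excluded. -/
theorem up_le_down (hM : IsConnector M a c) {x y : TLat α} :
    up M a c α x ≤ down M a c α y ↔ x = ⊥ ∧ y = ⊥ ∧ c ≤ a := by
  refine (Glue.ofUpper_le_lower (isAtom_lower hM)).trans ?_
  rw [Glue.ofUpper_le_lower (FruchtT.isAtom_atom _), ← le_bot_iff]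
  change Glue.ofUpper x ≤ Glue.lower ⊥ ∧ _ ∨ _ ∧ y = ⊥ ↔ _
  rw [Glue.ofUpper_le_lower (FruchtT.isAtom_atom _)]
  have h1 := hM.coatom_ne_bot
  have h2 := hM.atom_ne_top
  have h3 : (⊥ : M) ≠ ⊤ := fun h => h1 (le_bot_iff.1 (h ▸ le_top))
  simp only [le_bot_iff, h1, h2, h3]
  tauto

theorem exists_eq (x : S0 M a c α) :
    (∃ t, x = down M a c α t) ∨ (∃ m, x = mid M a c α m) ∨ ∃ t, x = up M a c α t := by
  obtain ⟨x, rfl⟩ | ⟨x, rfl⟩ := Glue.exists_eq x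
  · exact Or.inl ⟨x, rfl⟩
  · obtain ⟨x, rfl⟩ | ⟨x, rfl⟩ := Glue.exists_eq x
    · exact Or.inr (Or.inl ⟨x, rfl⟩)
    · exact Or.inr (Or.inr ⟨x, rfl⟩)

theorem mid_bot (hM : IsConnector M a c) :
    mid M a c α ⊥ = down M a c α (FruchtT.atom (idxZero α)) :=
  le_antisymm ((mid_le_down hM).2 (Or.inl ⟨rfl, le_rfl⟩)) ((down_le_mid hM).2 (Or.inl le_rfl))

theorem mid_atom (hM : IsConnector M a c) : mid M a c α a = down M a c α ⊥ :=
  le_antisymm ((mid_le_down hM).2 (Or.inr ⟨le_rfl, rfl⟩)) ((down_le_mid hM).2 (Or.inr le_rfl))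

theorem mid_coatom (hM : IsConnector M a c) : mid M a c α c = up M a c α ⊥ :=
  le_antisymm ((mid_le_up hM).2 (Or.inl le_rfl)) ((up_le_mid hM).2 (Or.inl ⟨rfl, le_rfl⟩))

theorem mid_top (hM : IsConnector M a c) :
    mid M a c α ⊤ = up M a c α (FruchtT.atom (idxZero α)) :=
  le_antisymm ((mid_le_up hM).2 (Or.inr le_rfl)) ((up_le_mid hM).2 (Or.inr ⟨le_rfl, rfl⟩))

/-- The dual automorphism of `M` extends to `S_0(α)`. -/
theorem exists_dualIso (hM : IsConnector M a c) : ∃ F : S0 M a c α ≃o (S0 M a c α)ᵒᵈ,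
    (∀ t, F (down M a c α t) = OrderDual.toDual (up M a c α t)) ∧
      ∀ t, F (up M a c α t) = OrderDual.toDual (down M a c α t) := by
  obtain ⟨δ, hδa, hδc⟩ := hM.selfdual
  -- Three overlapping pieces cover `S_0(α)`; `s` exchanges the outer two and applies `δ` in the
  -- middle.
  let π : TLat α ⊕ M ⊕ TLat α → S0 M a c α :=
    Sum.elim (down M a c α) (Sum.elim (mid M a c α) (up M a c α))
  let s : TLat α ⊕ M ⊕ TLat α → TLat α ⊕ M ⊕ TLat α :=
    Sum.elim (fun t => Sum.inr (Sum.inr t))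
      (Sum.elim (fun m => Sum.inr (Sum.inl (OrderDual.ofDual (δ m)))) Sum.inl)
  have hπ : π.Surjective := fun x => by
    obtain ⟨t, rfl⟩ | ⟨m, rfl⟩ | ⟨t, rfl⟩ := exists_eq x
    exacts [⟨Sum.inl t, rfl⟩, ⟨Sum.inr (Sum.inl m), rfl⟩, ⟨Sum.inr (Sum.inr t), rfl⟩]
  have hs : s.Surjective := by
    rintro (t | m | t)
    · exact ⟨Sum.inr (Sum.inr t), rfl⟩
    · exact ⟨Sum.inr (Sum.inl (δ.symm (OrderDual.toDual m))), by simp [s]⟩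
    · exact ⟨Sum.inl t, rfl⟩
  have h1 : ∀ m n : M, OrderDual.ofDual (δ n) ≤ OrderDual.ofDual (δ m) ↔ m ≤ n :=
    fun m n => δ.le_iff_le
  -- `δ` exchanges `a` with `c` and `⊥` with `⊤`; this turns each of the nine comparison formulas
  -- between the pieces into its dual.
  have ha : ∀ m : M, c ≤ OrderDual.ofDual (δ m) ↔ m ≤ a := fun m => by
    rw [← h1 m a, hδa, OrderDual.ofDual_toDual]
  have ha' : ∀ m : M, OrderDual.ofDual (δ m) ≤ c ↔ a ≤ m := fun m => by
    rw [← h1 a m, hδa, OrderDual.ofDual_toDual]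
  have hc : ∀ m : M, a ≤ OrderDual.ofDual (δ m) ↔ m ≤ c := fun m => by
    rw [← h1 m c, hδc, OrderDual.ofDual_toDual]
  have hc' : ∀ m : M, OrderDual.ofDual (δ m) ≤ a ↔ c ≤ m := fun m => by
    rw [← h1 c m, hδc, OrderDual.ofDual_toDual]
  have hb : ∀ m : M, OrderDual.ofDual (δ m) = ⊥ ↔ m = ⊤ := fun m => by
    have : OrderDual.ofDual (δ ⊤) = ⊥ := congrArg OrderDual.ofDual (map_top δ)
    rw [← le_bot_iff, ← this, h1, top_le_iff]
  have ht : ∀ m : M, OrderDual.ofDual (δ m) = ⊤ ↔ m = ⊥ := fun m => by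
    have : OrderDual.ofDual (δ ⊥) = ⊤ := congrArg OrderDual.ofDual (map_bot δ)
    rw [← top_le_iff, ← this, h1, le_bot_iff]
  obtain ⟨F, hF⟩ := exists_orderIso_of_surjective (X := S0 M a c α) (Y := (S0 M a c α)ᵒᵈ)
    (π := π) (ρ := fun p => OrderDual.toDual (π p)) hπ (OrderDual.toDual.surjective.comp hπ) hs
    (by
      rintro (t | m | t) (t' | m' | t') <;>
        simp only [π, s, Sum.elim_inl, Sum.elim_inr, OrderDual.toDual_le_toDual, down_le_down,
          down_le_mid hM, mid_le_down hM, mid_le_mid hM, mid_le_up hM, up_le_mid hM, up_le_up hM,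
          down_le_up hM, up_le_down hM, h1, ha, ha', hc, hc', hb, ht]
      all_goals tauto)
  exact ⟨F, fun t => hF (Sum.inl t), fun t => hF (Sum.inr (Sum.inr t))⟩

end S0

/-! ### Simplicity and selfduality of `S(α)` -/

namespace SLat

variable {M : Type} [PartialOrder M] [BoundedOrder M] {a c : M} {α : Ordinal.{u}}
    {N : Type} [PartialOrder N] [BoundedOrder N]

theorem isSimpleOrderedSet (hM : IsConnector M a c) (hN : IsEdgeFiller N) (α : Ordinal.{u}) :
    IsSimpleOrderedSet (SLat M a c α N) := by
  have hT : IsSimpleOrderedSet (TLat α) := FruchtT.isSimpleOrderedSet Idx.exists_ne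
  have h0 := FruchtT.isAtom_atom (idxZero α)
  let _ : OrderTop (UpperPart M c α) := Glue.orderTop hM.coatom h0
  let _ : OrderTop (S0 M a c α) := Glue.orderTop S0.isCoatom_dual (S0.isAtom_lower hM)
  let _ : BoundedOrder (S0 M a c α) := {}
  exact EdgeReplace.isSimpleOrderedSet
    (Glue.isSimpleOrderedSet S0.isCoatom_dual (S0.isAtom_lower hM) hT.dual
      (Glue.isSimpleOrderedSet hM.coatom h0 hM.simple.isSimpleOrderedSet hT))
    hN.simple.isSimpleOrderedSet

/-- The matching of upper edges with lower edges. -/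
def edgeSwap (α : Ordinal.{u}) : SEdge α ≃ SEdge α where
  toFun
    | ⟨i, j, h, .upperLeft⟩ => ⟨i, j, h, .lowerLeft⟩
    | ⟨i, j, h, .upperRight⟩ => ⟨i, j, h, .lowerRight⟩
    | ⟨i, j, h, .lowerLeft⟩ => ⟨i, j, h, .upperLeft⟩
    | ⟨i, j, h, .lowerRight⟩ => ⟨i, j, h, .upperRight⟩
  invFun
    | ⟨i, j, h, .upperLeft⟩ => ⟨i, j, h, .lowerLeft⟩
    | ⟨i, j, h, .upperRight⟩ => ⟨i, j, h, .lowerRight⟩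
    | ⟨i, j, h, .lowerLeft⟩ => ⟨i, j, h, .upperLeft⟩
    | ⟨i, j, h, .lowerRight⟩ => ⟨i, j, h, .upperRight⟩
  left_inv := by rintro ⟨i, j, h, _ | _⟩ <;> rfl
  right_inv := by rintro ⟨i, j, h, _ | _⟩ <;> rfl

/-- Left edges carry `N` above and its dual below, right edges the other way round, so `edgeSwap`
always pairs a copy of `N` with a copy of its dual. The recorded value says that the filter above
`c` is sent to the ideal below `a`. -/
theorem exists_dualIso (hM : IsConnector M a c) (N : Type) [PartialOrder N] [BoundedOrder N]
    (α : Ordinal.{u}) : ∃ G : SLat M a c α N ≃o (SLat M a c α N)ᵒᵈ,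
      G (.base (S0.up M a c α ⊥)) = OrderDual.toDual (.base (S0.down M a c α ⊥)) := by
  obtain ⟨F, hF, hF'⟩ := S0.exists_dualIso (α := α) hM
  obtain ⟨G, hG⟩ := EdgeReplace.exists_dualIso (N := N) (F := SEdge.family M a c α)
    (F' := SEdge.family M a c α) F (edgeSwap α)
    (by rintro ⟨i, j, h, _ | _⟩ <;> first | exact hF _ | exact hF' _)
    (by rintro ⟨i, j, h, _ | _⟩ <;> first | exact hF _ | exact hF' _)
    (by rintro ⟨i, j, h, _ | _⟩ <;> rfl)
  exact ⟨G, by rw [hG, hF']; rfl⟩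

end SLat

/-! ### Length -/

/-- The length of a poset is certified by a bounded strictly increasing function and a chain. -/
theorem hasLength_of_strictMono {X : Type u} [PartialOrder X] {n : ℕ} {φ : X → ℕ}
    (hφ : StrictMono φ) (hn : ∀ x, φ x ≤ n) {s : Fin (n + 1) → X} (hs : StrictMono s) :
    HasLength X n := by
  refine le_antisymm (iSup_le fun p => ?_) ?_
  · have h := LTSeries.head_add_length_le_nat (p.map φ hφ)
    have h1 := hn (RelSeries.last p)
    have h2 : p.length ≤ n := by
      simp only [LTSeries.map_length, LTSeries.last_map] at h
      omega
    exact_mod_cast h2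
  · exact Order.le_krullDim_iff.2 ⟨LTSeries.mk n s hs, rfl⟩

/-- The height of an element is bounded by the length of the poset, hence finite, and on elements of
finite height it is strictly increasing. -/
theorem HasLength.exists_strictMono {X : Type u} [PartialOrder X] {n : ℕ} (h : HasLength X n) :
    ∃ φ : X → ℕ, StrictMono φ ∧ ∀ x, φ x ≤ n := by
  have hle : ∀ x : X, Order.height x ≤ (n : ℕ∞) := fun x => by
    have := Order.height_le_krullDim x
    rw [show Order.krullDim X = _ from h] at this
    exact_mod_cast this
  have hlt : ∀ x : X, Order.height x < ⊤ := fun x => (hle x).trans_lt (ENat.natCast_lt_top n)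
  refine ⟨fun x => (Order.height x).toNat, fun x y hxy => ?_, fun x =>
    ENat.toNat_le_of_le_natCast (hle x)⟩
  have h1 := Order.height_strictMono hxy (hlt x)
  rwa [← ENat.natCast_toNat (hlt x).ne, ← ENat.natCast_toNat (hlt y).ne, Nat.cast_lt] at h1

namespace EdgeReplace

variable {L : Type u} [PartialOrder L] {E : Type v} {F : EdgeFamily L E}
    {N : Type w} [PartialOrder N] [BoundedOrder N]

/-- A strictly increasing function on `L` that grows by at least `n` along the edges extends if `n`
bounds a strictly increasing function on `N`. -/
theorem exists_strictMono {n : ℕ} {φ : L → ℕ} (hφ : StrictMono φ)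
    (hF : ∀ e, φ (F.lo e) + n ≤ φ (F.hi e)) {ψ : N → ℕ} (hψ : StrictMono ψ) (hn : ∀ x, ψ x ≤ n)
    {k : ℕ} (hk : ∀ x, φ x ≤ k) :
    ∃ ρ : EdgeReplace F N → ℕ, StrictMono ρ ∧ ∀ x, ρ x ≤ k := by
  have h0 : ∀ s : Interior N, 0 < ψ s := fun s => Nat.zero_le _ |>.trans_lt (hψ s.2.1.bot_lt)
  have h1 : ∀ s : Interior N, ψ s < n := fun s => (hψ s.2.2.lt_top).trans_le (hn _)
  let ρ : EdgeReplace F N → ℕ := fun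
    | base x => φ x
    | inner e s => φ (F.lo e) + if F.reversed e then n - ψ s else ψ s
  have hlo : ∀ e s, φ (F.lo e) < ρ (inner e s) := fun e s => by
    have := h0 s
    have := h1 s
    simp only [ρ]
    split_ifs <;> omega
  have hhi : ∀ e s, ρ (inner e s) < φ (F.hi e) := fun e s => by
    have := h0 s
    have := h1 s
    have := hF e
    simp only [ρ]
    split_ifs <;> omega
  refine ⟨ρ, ?_, ?_⟩
  · rintro (x | ⟨e, s⟩) (y | ⟨e', t⟩) h
    · exact hφ (lt_of_le_of_ne h.le fun h' => h.ne (congrArg _ h'))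
    · exact (hφ.monotone (base_le_inner.1 h.le)).trans_lt (hlo e' t)
    · exact (hhi e s).trans_le (hφ.monotone (inner_le_base.1 h.le))
    · rcases inner_le_inner.1 h.le with ⟨rfl, h2⟩ | h2
      · have hne : s ≠ t := fun h' => h.ne (congrArg _ h')
        have := h1 s
        have := h1 t
        simp only [ρ]
        split_ifs at h2 ⊢
        · have : ψ t < ψ s := hψ (lt_of_le_of_ne h2 fun h' => hne (Subtype.ext h'.symm))
          omega
        · have : ψ s < ψ t := hψ (lt_of_le_of_ne h2 fun h' => hne (Subtype.ext h'))
          omega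
      · exact ((hhi e s).trans_le (hφ.monotone h2)).trans (hlo e' t)
  · rintro (x | ⟨e, s⟩)
    · exact hk x
    · exact (hhi e s).le.trans (hk _)

end EdgeReplace

/-- The height of the elements of `T(α)` in `S_0(α)` if the replaced edges have weight three. -/
def FruchtT.weightedHeight {I : Type u} [LinearOrder I] : FruchtT I → ℕ
  | bot => 7
  | atom _ => 8
  | coatom _ _ _ => 11
  | top => 12

theorem FruchtT.weightedHeight_strictMono {I : Type u} [LinearOrder I] :
    StrictMono (weightedHeight : FruchtT I → ℕ) := by
  rintro (_ | _ | i | ⟨i, j, h⟩) (_ | _ | k | ⟨k, l, h'⟩) hlt <;>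
    first
    | exact (hlt.ne rfl).elim
    | exact hlt.le.elim
    | (obtain rfl := FruchtT.atom_le_atom.1 hlt.le; exact (hlt.ne rfl).elim)
    | (obtain ⟨rfl, rfl⟩ := FruchtT.coatom_le_coatom.1 hlt.le; exact (hlt.ne rfl).elim)
    | simp [weightedHeight]

namespace S0

variable {M : Type} [PartialOrder M] [BoundedOrder M] {a c : M} {α : Ordinal.{u}}

/-- The height function of `S_0(α)` in which the replaced edges have weight three. -/
noncomputable def weightedHeight (ht : M → ℕ) : S0 M a c α → ℕ
  -- `T'(α)` gets the values 0, 1, 4, 5, the remaining elements of `M` get `4 + ht`, and those of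
  -- `T(α)` get 8, 11, 12. The jumps from 1 to 4 and from 8 to 11 leave room for `N`.
  | .lower x => 12 - (OrderDual.ofDual x).weightedHeight
  | .upper (.lower m) _ => 4 + ht m
  | .upper (.upper t _) _ => t.weightedHeight

theorem weightedHeight_le {ht : M → ℕ} (hle : ∀ m, ht m ≤ 4) (x : S0 M a c α) :
    weightedHeight ht x ≤ 12 := by
  have h : ∀ t : TLat α, t.weightedHeight ≤ 12 := fun t =>
    FruchtT.weightedHeight_strictMono.monotone (le_top : t ≤ ⊤)
  rcases x with x | ⟨m | ⟨t, ht'⟩, hm⟩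
  · exact Nat.sub_le _ _
  · have := hle m
    change 4 + ht m ≤ 12
    omega
  · exact h t

theorem weightedHeight_strictMono (hM : IsConnector M a c) {ht : M → ℕ} (h : StrictMono ht)
    (hle : ∀ m, ht m ≤ 4) :
    StrictMono (weightedHeight ht : S0 M a c α → ℕ) := by
  have hT := FruchtT.weightedHeight_strictMono (I := Idx α)
  have hbot : ∀ t : TLat α, 7 ≤ t.weightedHeight := fun t => hT.monotone (bot_le : ⊥ ≤ t)
  have htop : ∀ t : TLat α, t.weightedHeight ≤ 12 := fun t => hT.monotone (le_top : t ≤ ⊤)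
  have h0 : ∀ m, m ≠ ⊥ → 0 < ht m := fun m hm => Nat.zero_le _ |>.trans_lt (h hm.bot_lt)
  have h4 : ∀ m, m ≠ ⊤ → ht m < 4 := fun m hm => (h hm.lt_top).trans_le (hle _)
  rintro (x | ⟨m | ⟨t, ht'⟩, hm⟩) (y | ⟨n | ⟨s, hs⟩, hn⟩) hlt
  · have h1 : OrderDual.ofDual y < OrderDual.ofDual x :=
      lt_of_le_of_ne hlt.le fun h' => hlt.ne (congrArg _ h'.symm)
    have h2 := hT h1
    have h3 := htop (OrderDual.ofDual x)
    change 12 - (OrderDual.ofDual x).weightedHeight < 12 - (OrderDual.ofDual y).weightedHeight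
    omega
  · have hn0 := h0 n fun h => hn.1 (congrArg _ h)
    change 12 - (OrderDual.ofDual x).weightedHeight < 4 + ht n
    rcases Glue.lower_le_upper.1 hlt.le with h1 | h1
    · have h2 : 8 ≤ (OrderDual.ofDual x).weightedHeight :=
        hT.monotone (show FruchtT.atom (idxZero α) ≤ OrderDual.ofDual x from h1)
      omega
    · have h2 := hbot (OrderDual.ofDual x)
      have h3 : a < n := lt_of_le_of_ne h1 fun h => hn.2 (congrArg _ h.symm)
      have h4 := h h3
      have h5 := h hM.atom.bot_lt
      omega
  · have h1 := hT (lt_of_le_of_ne bot_le hs.1.symm : ⊥ < s)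
    have h2 := hbot (OrderDual.ofDual x)
    have h3 : (⊥ : TLat α).weightedHeight = 7 := rfl
    change 12 - (OrderDual.ofDual x).weightedHeight < s.weightedHeight
    omega
  · exact (Glue.not_upper_le_lower hlt.le).elim
  · have h1 : m ≤ n := hlt.le
    replace h1 : m < n := lt_of_le_of_ne h1 fun h' => by
      subst h'
      exact hlt.ne rfl
    exact Nat.add_lt_add_left (h h1) 4
  · have h1 := hT (lt_of_le_of_ne bot_le hs.1.symm : ⊥ < s)
    have h3 : (⊥ : TLat α).weightedHeight = 7 := rfl
    change 4 + ht m < s.weightedHeight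
    by_cases hm' : m = ⊤
    · have h2 : m ≤ c ∨ FruchtT.atom (idxZero α) ≤ s := Glue.upper_le_upper.1 hlt.le
      rcases h2 with h2 | h2
      · exact (hM.coatom.1 (top_le_iff.1 (hm' ▸ h2))).elim
      · have h4 := hT (lt_of_le_of_ne h2 hs.2.symm)
        have h5 := hle m
        have h6 : (FruchtT.atom (idxZero α) : TLat α).weightedHeight = 8 := rfl
        omega
    · have := h4 m hm'
      omega
  · exact (Glue.not_upper_le_lower hlt.le).elim
  · exact (Glue.not_upper_le_lower (Glue.upper_le_upper.1 hlt.le)).elim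
  · have h1 : t < s := lt_of_le_of_ne (Glue.upper_le_upper.1 (Glue.upper_le_upper.1 hlt.le))
      fun h' => by
        subst h'
        exact hlt.ne rfl
    exact hT h1

theorem weightedHeight_up (hM : IsConnector M a c) {ht : M → ℕ} (h4 : ht ⊤ = 4)
    (t : TLat α) (ht' : t ≠ ⊥) :
    weightedHeight ht (up M a c α t) = t.weightedHeight := by
  by_cases h1 : t = FruchtT.atom (idxZero α)
  · have h2 : (Glue.lower ⊤ : UpperPart M c α) ≠ ⊥ ∧
        (Glue.lower ⊤ : UpperPart M c α) ≠ Glue.lower a :=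
      ⟨fun h => hM.coatom_ne_bot (le_bot_iff.1 (by
        rw [show (⊥ : M) = ⊤ from (Glue.lower.inj h).symm]
        exact le_top)), fun h => hM.atom_ne_top (Glue.lower.inj h).symm⟩
    rw [h1, ← mid_top hM, mid, Glue.ofUpper_eq_upper h2]
    exact congrArg (4 + ·) h4
  · have h2 : (Glue.upper t ⟨ht', h1⟩ : UpperPart M c α) ≠ ⊥ ∧
        (Glue.upper t ⟨ht', h1⟩ : UpperPart M c α) ≠ Glue.lower a :=
      ⟨(nofun : Glue.upper t _ ≠ Glue.lower ⊥), nofun⟩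
    rw [up, Glue.ofUpper_eq_upper ⟨ht', h1⟩, Glue.ofUpper_eq_upper h2]
    rfl

end S0

theorem SLat.hasLength {M : Type} [PartialOrder M] [BoundedOrder M] {a c : M}
    {N : Type} [PartialOrder N] [BoundedOrder N] (hM : IsConnector M a c) (hN : IsEdgeFiller N)
    (α : Ordinal.{u}) : HasLength (SLat M a c α N) 12 := by
  obtain ⟨ht, hmono, hle⟩ := hM.length.exists_strictMono
  obtain ⟨ψ, hψ, hψ3⟩ := hN.length.exists_strictMono
  obtain ⟨x, y, z, hx, hxy, hyz, hz⟩ := hM.exists_chain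
  obtain ⟨p, q, hp, hpq, hq⟩ := hN.exists_chain
  have h4 : ht ⊤ = 4 := by
    have := hmono hx
    have := hmono hxy
    have := hmono hyz
    have := hmono hz
    have := hle ⊤
    omega
  obtain ⟨ρ, hρ, hρ'⟩ := EdgeReplace.exists_strictMono (F := SEdge.family M a c α) (N := N)
    (n := 3) (S0.weightedHeight_strictMono (α := α) hM hmono hle) (by
      rintro ⟨i, j, h, _ | _⟩
      · change S0.weightedHeight ht (S0.up M a c α _) + 3 ≤ S0.weightedHeight ht (S0.up M a c α _)
        rw [S0.weightedHeight_up hM h4 _ FruchtT.atom_ne_bot,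
          S0.weightedHeight_up hM h4 _ FruchtT.coatom_ne_bot]
        rfl
      · change S0.weightedHeight ht (S0.up M a c α _) + 3 ≤ S0.weightedHeight ht (S0.up M a c α _)
        rw [S0.weightedHeight_up hM h4 _ FruchtT.atom_ne_bot,
          S0.weightedHeight_up hM h4 _ FruchtT.coatom_ne_bot]
        rfl
      · exact le_rfl
      · exact le_rfl) hψ hψ3 (S0.weightedHeight_le hle)
  obtain ⟨j, hj, -⟩ := Idx.exists_ne (idxZero α) (idxZero α) (idxZero α)
  have h0j : idxZero α < j := lt_of_le_of_ne (zero_le : (0 : Ordinal.{u}) ≤ j.1) hj.symm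
  have hp' : p ≠ ⊥ ∧ p ≠ ⊤ := ⟨hp.ne', (hpq.trans hq).ne⟩
  have hq' : q ≠ ⊥ ∧ q ≠ ⊤ := ⟨(hp.trans hpq).ne', hq.ne⟩
  have hmid : ∀ m n : M, m < n → (.base (S0.mid M a c α m) : SLat M a c α N) <
      .base (S0.mid M a c α n) := fun m n h =>
    lt_of_le_not_ge ((S0.mid_le_mid hM).2 h.le) fun h' => h.not_ge ((S0.mid_le_mid hM).1 h')
  -- The chain runs along the edges of the pair `{0, j}`, since `h^0` is the bottom of `M` and `g_0`
  -- its top. The lower left copy is the dual of `N`, so there `q` comes before `p`.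
  let s : Fin 13 → SLat M a c α N := ![.base (S0.down M a c α ⊤),
    .base (S0.down M a c α (.coatom _ j h0j)), .inner ⟨_, j, h0j, .lowerLeft⟩ ⟨q, hq'⟩,
    .inner ⟨_, j, h0j, .lowerLeft⟩ ⟨p, hp'⟩, .base (S0.mid M a c α ⊥),
    .base (S0.mid M a c α x), .base (S0.mid M a c α y), .base (S0.mid M a c α z),
    .base (S0.mid M a c α ⊤), .inner ⟨_, j, h0j, .upperLeft⟩ ⟨p, hp'⟩,
    .inner ⟨_, j, h0j, .upperLeft⟩ ⟨q, hq'⟩, .base (S0.up M a c α (.coatom _ j h0j)),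
    .base (S0.up M a c α ⊤)]
  refine hasLength_of_strictMono hρ hρ' (s := s) (Fin.strictMono_iff_lt_succ.2 fun i => ?_)
  fin_cases i
  · exact lt_of_le_of_ne (EdgeReplace.base_le_base.2 (S0.down_le_down.2 le_top)) nofun
  · exact lt_of_le_of_ne (EdgeReplace.base_le_inner.2 le_rfl) nofun
  · refine lt_of_le_of_ne (EdgeReplace.inner_le_inner.2 (Or.inl ⟨rfl, hpq.le⟩)) fun h => ?_
    injection h with _ h
    exact hpq.ne' (congrArg Subtype.val h)
  · refine lt_of_le_of_ne (EdgeReplace.inner_le_base.2 ?_) nofun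
    rw [S0.mid_bot hM]
    rfl
  · exact hmid _ _ hx
  · exact hmid _ _ hxy
  · exact hmid _ _ hyz
  · exact hmid _ _ hz
  · refine lt_of_le_of_ne (EdgeReplace.base_le_inner.2 ?_) nofun
    rw [S0.mid_top hM]
    rfl
  · refine lt_of_le_of_ne (EdgeReplace.inner_le_inner.2 (Or.inl ⟨rfl, hpq.le⟩)) fun h => ?_
    injection h with _ h
    exact hpq.ne (congrArg Subtype.val h)
  · exact lt_of_le_of_ne (EdgeReplace.inner_le_base.2 le_rfl) nofun
  · exact lt_of_le_not_ge (EdgeReplace.base_le_base.2 ((S0.up_le_up hM).2 le_top)) fun h =>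
      FruchtT.not_top_le_coatom ((S0.up_le_up hM).1 h)

/-! ### The lower part of `S(α)` -/

namespace FruchtT

variable {I : Type u} [LinearOrder I]

theorem not_bot_or_atom_iff {x : FruchtT I} :
    ¬ (x = ⊥ ∨ ∃ i, x = atom i) ↔ x = ⊤ ∨ ∃ i j h, x = edge i j h := by
  obtain rfl | rfl | ⟨i, rfl⟩ | ⟨i, j, h, rfl⟩ := eq_cases x
  · simp only [true_or, not_true_eq_false, false_iff]
    rintro (h | ⟨i, j, h, h'⟩)
    · exact not_top_le_bot h.ge
    · exact not_edge_le_bot h'.ge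
  · simp only [true_or, iff_true]
    rintro (h | ⟨i, h⟩)
    · exact not_top_le_bot h.le
    · exact not_top_le_atom h.le
  · simp only [atom.injEq, exists_eq', or_true, not_true_eq_false, false_iff]
    rintro (h | ⟨k, l, h, h'⟩)
    · exact not_top_le_atom h.ge
    · exact not_edge_le_atom h'.ge
  · refine ⟨fun _ => Or.inr ⟨i, j, h, rfl⟩, fun _ => ?_⟩
    rintro (h | ⟨k, h⟩)
    · exact not_edge_le_bot h.le
    · exact not_edge_le_atom h.le

theorem edge_ne_top {i j : I} {h : i ≠ j} : edge i j h ≠ ⊤ := fun h' => not_top_le_edge h'.ge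

theorem eq_or_eq_of_le_edge {i j : I} {h : i ≠ j} {x : FruchtT I} (h1 : atom i ≤ x)
    (h2 : x ≤ edge i j h) : x = atom i ∨ x = edge i j h := by
  obtain rfl | rfl | ⟨k, rfl⟩ | ⟨k, l, hkl, rfl⟩ := eq_cases x
  · exact (not_atom_le_bot h1).elim
  · exact (not_top_le_edge h2).elim
  · exact Or.inl (congrArg _ (atom_le_atom.1 h1).symm)
  · rcases eq_of_edge_le h2 with h3 | h3
    · exact Or.inr h3.symm
    · exact (edge_ne_top h3).elim

theorem eq_of_edge_le_edge {i j k l : I} {h : i ≠ j} {h' : k ≠ l} (hle : edge i j h ≤ edge k l h') :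
    edge i j h = edge k l h' :=
  ((eq_of_edge_le hle).resolve_right edge_ne_top).symm

theorem exists_le_edge {x : FruchtT I} (hx : x ≠ ⊤) (hI : ∀ i : I, ∃ j, i ≠ j) [Nonempty I] :
    ∃ i j h, x ≤ edge i j h := by
  obtain rfl | rfl | ⟨i, rfl⟩ | ⟨i, j, h, rfl⟩ := eq_cases x
  · obtain ⟨j, hj⟩ := hI (Classical.arbitrary I)
    exact ⟨_, j, hj, bot_le⟩
  · exact (hx rfl).elim
  · obtain ⟨j, hj⟩ := hI i
    exact ⟨i, j, hj, atom_le_edge.2 (Or.inl rfl)⟩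
  · exact ⟨i, j, h, le_rfl⟩

end FruchtT

namespace SLat

open FruchtT EdgeReplace

variable {M : Type} [PartialOrder M] [BoundedOrder M] {a c : M} {α β : Ordinal.{u}}
    {N : Type} [PartialOrder N] [BoundedOrder N]

variable (M a c α N) in
/-- The canonical map of `T'(α)`, viewed as the dual of `T(α)`, into `S(α)`. -/
def down (t : TLat α) : SLat M a c α N := base (S0.down M a c α t)

variable (M a c α N) in
/-- The canonical map of `T(α)` into `S(α)`. -/
noncomputable def up (t : TLat α) : SLat M a c α N := base (S0.up M a c α t)

variable (M a c α N) in
/-- The canonical map of `M` into `S(α)`. -/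
noncomputable def mid (m : M) : SLat M a c α N := base (S0.mid M a c α m)

theorem down_le_down {x y : TLat α} : down M a c α N x ≤ down M a c α N y ↔ y ≤ x := Iff.rfl

theorem down_injective : Function.Injective (down M a c α N) := fun _ _ h =>
  le_antisymm (down_le_down.1 h.ge) (down_le_down.1 h.le)

theorem isLUB_down {x y z : TLat α} (h : IsGLB {x, y} z) :
    IsLUB {down M a c α N x, down M a c α N y} (down M a c α N z) :=
  by
  have h' : IsLUB {OrderDual.toDual x, OrderDual.toDual y} (OrderDual.toDual z) := h
  exact preservesJoinMeet_base.lub (Glue.preservesJoinMeet_lower.lub h')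

/-! ### Atoms of `S(α)`, their joins, and the induced bijection of indices. -/

theorem exists_edge_le (hM : IsConnector M a c) {x : SLat M a c α N}
    (hx : x ≠ down M a c α N ⊤) : ∃ i j h, down M a c α N (edge i j h) ≤ x := by
  have hI : ∀ i : Idx α, ∃ j, i ≠ j := fun i => by
    obtain ⟨j, hj, -⟩ := Idx.exists_ne i i i
    exact ⟨j, hj.symm⟩
  have h0 : ∃ i j h, atom (idxZero α) ≤ edge i j h := exists_le_edge nofun hI
  have hmid : ∀ m, ∃ i j h, down M a c α N (edge i j h) ≤ mid M a c α N m := fun m => by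
    obtain ⟨i, j, h, h'⟩ := h0
    exact ⟨i, j, h, (S0.down_le_mid hM).2 (Or.inl h')⟩
  have hup : ∀ t, ∃ i j h, down M a c α N (edge i j h) ≤ up M a c α N t := fun t => by
    obtain ⟨i, j, h, h'⟩ := h0
    exact ⟨i, j, h, (S0.down_le_up hM).2 (Or.inl h')⟩
  obtain x | ⟨e, s⟩ := x
  · obtain ⟨t, rfl⟩ | ⟨m, rfl⟩ | ⟨t, rfl⟩ := S0.exists_eq x
    · exact exists_le_edge (fun h => hx (h ▸ rfl)) hI
    · exact hmid m
    · exact hup t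
  · obtain ⟨i, j, h, _ | _⟩ := e
    · obtain ⟨k, l, h1, h2⟩ := hup (atom i)
      exact ⟨k, l, h1, h2⟩
    · obtain ⟨k, l, h1, h2⟩ := hup (atom j)
      exact ⟨k, l, h1, h2⟩
    · exact ⟨i, j, h.ne, coatom_eq_edge i j h ▸ base_le_inner.2 le_rfl⟩
    · exact ⟨i, j, h.ne, coatom_eq_edge i j h ▸ base_le_inner.2 le_rfl⟩

theorem isAtom_iff (hM : IsConnector M a c) {x : SLat M a c α N} :
    IsAtom x ↔ ∃ i j h, x = down M a c α N (edge i j h) := by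
  constructor
  · intro hx
    obtain ⟨i, j, h, hle⟩ := exists_edge_le hM hx.1
    refine ⟨i, j, h, ((hx.le_iff.1 hle).resolve_left fun h' => ?_).symm⟩
    exact edge_ne_top (down_injective h')
  · rintro ⟨i, j, h, rfl⟩
    refine ⟨fun h' => edge_ne_top (down_injective h'), fun y hy => ?_⟩
    by_contra hne
    obtain ⟨k, l, h', hle⟩ := exists_edge_le hM hne
    rw [eq_of_edge_le_edge (down_le_down.1 (hle.trans hy.le))] at hy
    exact hle.not_gt hy

/-- Read in `T'(α)`: `h^i` is the join of `h_{ij}` and `h_{ik}`, and the top is the join of the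
atoms of two disjoint pairs. This characterizes these elements by the order of `S(α)` alone. -/
theorem exists_edges_isGLB {x : TLat α} (hx : x = ⊥ ∨ ∃ i, x = atom i) :
    ∃ i j h k l h', edge i j h ≠ edge k l h' ∧ IsGLB {edge i j h, edge k l h'} x := by
  have hI : ∀ i j : Idx α, ∃ k, k ≠ i ∧ k ≠ j := fun i j =>
    (Idx.exists_ne i j j).imp fun _ h => ⟨h.1, h.2.1⟩
  -- The index `l` makes the two pairs distinct; the last hypothesis says that `x` has exactly their
  -- common atoms below it, which determines the meet.
  have key : ∀ (i j k l : Idx α) (h : i ≠ j) (h' : k ≠ l), l ≠ i → l ≠ j →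
      (∀ m, atom m ≤ x ↔ atom m ≤ edge i j h ∧ atom m ≤ edge k l h') →
      edge i j h ≠ edge k l h' ∧ IsGLB {edge i j h, edge k l h'} x := by
    intro i j k l h h' hi hj hx
    refine ⟨fun heq => ?_, isGLB_pair_iff.2 ⟨?_, ?_, fun w h1 h2 => ?_⟩⟩
    · have h1 := heq.ge
      rw [edge_le_edge] at h1
      tauto
    · exact (le_iff_atom_le hI).2 fun m hm => ((hx m).1 hm).1
    · exact (le_iff_atom_le hI).2 fun m hm => ((hx m).1 hm).2
    · exact (le_iff_atom_le hI).2 fun m hm => (hx m).2 ⟨hm.trans h1, hm.trans h2⟩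
  rcases hx with rfl | ⟨i, rfl⟩
  · obtain ⟨j, hj, -⟩ := hI (idxZero α) (idxZero α)
    obtain ⟨k, hk, hk'⟩ := hI (idxZero α) j
    obtain ⟨l, hl, hl', hl''⟩ := Idx.exists_ne (idxZero α) j k
    refine ⟨_, j, hj.symm, k, l, hl''.symm, key _ j k l _ _ hl hl' fun m => ?_⟩
    simp only [not_atom_le_bot, atom_le_edge, false_iff]
    grind
  · obtain ⟨j, hj, -⟩ := hI i i
    obtain ⟨k, hk, hk'⟩ := hI i j
    refine ⟨i, j, hj.symm, i, k, hk.symm, key i j i k _ _ hk hk' fun m => ?_⟩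
    simp only [atom_le_atom, atom_le_edge]
    grind

/-- Isomorphisms preserve atoms and joins of two distinct atoms. Conversely, such a join is some
`h^i` or the top of `T'(β)`, because the meet of two distinct coatoms of `T(β)` is neither a coatom
nor `⊤`. -/
theorem map_down (hM : IsConnector M a c) (f : SLat M a c α N ≃o SLat M a c β N) {x : TLat α}
    (hx : x = ⊥ ∨ ∃ i, x = atom i) :
    ∃ y : TLat β, (y = ⊥ ∨ ∃ i, y = atom i) ∧ f (down M a c α N x) = down M a c β N y := by
  obtain ⟨i, j, h, k, l, h', hne, hlub⟩ := exists_edges_isGLB hx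
  have hlub' := isLUB_down (M := M) (a := a) (c := c) (N := N) hlub
  have hf : ∀ i j h, ∃ i' j' h', f (down M a c α N (edge i j h)) =
      down M a c β N (edge i' j' h') := fun i j h =>
    (isAtom_iff hM).1 ((OrderIso.isAtom_iff f _).2 ((isAtom_iff hM).2 ⟨i, j, h, rfl⟩))
  obtain ⟨i₁, j₁, h₁, e₁⟩ := hf i j h
  obtain ⟨i₂, j₂, h₂, e₂⟩ := hf k l h'
  obtain ⟨y, hy⟩ := FruchtT.exists_isGLB
    (fun i j => (Idx.exists_ne i j j).imp fun _ h => ⟨h.1, h.2.1⟩) (edge i₁ j₁ h₁) (edge i₂ j₂ h₂)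
  refine ⟨y, ?_, ?_⟩
  · by_contra hc
    have hne' : edge i₁ j₁ h₁ ≠ edge i₂ j₂ h₂ := fun h => hne
      (down_injective (f.injective (e₁.trans ((congrArg _ h).trans e₂.symm))))
    rw [isGLB_pair_iff] at hy
    rcases not_bot_or_atom_iff.1 hc with rfl | ⟨i₃, j₃, h₃, rfl⟩
    · exact not_top_le_edge hy.1
    · exact hne' ((eq_of_edge_le_edge hy.1).symm.trans (eq_of_edge_le_edge hy.2.1))
  · have h1 : IsLUB {f (down M a c α N (edge i j h)), f (down M a c α N (edge k l h'))}
        (f (down M a c α N x)) := by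
      have := (OrderIso.isLUB_image' f).2 hlub'
      rwa [Set.image_pair] at this
    rw [e₁, e₂] at h1
    exact h1.unique (isLUB_down hy)

/-- `down ⊥`, the top of `T'(α)`, is the greatest of the joins in `map_down`. -/
theorem map_down_bot (hM : IsConnector M a c) (f : SLat M a c α N ≃o SLat M a c β N) :
    f (down M a c α N ⊥) = down M a c β N ⊥ := by
  obtain ⟨y, -, h1⟩ := map_down hM f (Or.inl rfl)
  obtain ⟨z, -, h2⟩ := map_down hM f.symm (Or.inl rfl)
  have h3 : down M a c β N y ≤ down M a c β N ⊥ := down_le_down.2 bot_le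
  have h4 : down M a c α N z ≤ down M a c α N ⊥ := down_le_down.2 bot_le
  refine le_antisymm (h1 ▸ h3) ?_
  rwa [← h2, f.symm_apply_le] at h4

theorem exists_map_atom (hM : IsConnector M a c) (f : SLat M a c α N ≃o SLat M a c β N)
    (i : Idx α) : ∃ j : Idx β, f (down M a c α N (atom i)) = down M a c β N (atom j) := by
  obtain ⟨y, rfl | ⟨j, rfl⟩, h⟩ := map_down hM f (Or.inr ⟨i, rfl⟩)
  · rw [← map_down_bot hM f] at h
    exact (atom_ne_bot (down_injective (f.injective h))).elim
  · exact ⟨j, h⟩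

/-- The bijection of the indices induced by an isomorphism. -/
theorem exists_indexEquiv (hM : IsConnector M a c) (f : SLat M a c α N ≃o SLat M a c β N) :
    ∃ σ : Idx α ≃ Idx β, ∀ i, f (down M a c α N (atom i)) = down M a c β N (atom (σ i)) := by
  choose σ hσ using exists_map_atom hM f
  choose τ hτ using exists_map_atom hM f.symm
  refine ⟨⟨σ, τ, fun i => ?_, fun j => ?_⟩, hσ⟩
  · have h := hτ (σ i)
    rw [← hσ, f.symm_apply_apply] at h
    exact (atom_le_atom.1 (down_le_down.1 h.ge)).symm
  · have h := hσ (τ j)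
    rw [← hτ, f.apply_symm_apply] at h
    exact (atom_le_atom.1 (down_le_down.1 h.ge)).symm

/-- `h_{ij}` is the only atom below both `h^i` and `h^j`. -/
theorem map_down_edge (hM : IsConnector M a c) (f : SLat M a c α N ≃o SLat M a c β N)
    {σ : Idx α ≃ Idx β} (hσ : ∀ i, f (down M a c α N (atom i)) = down M a c β N (atom (σ i)))
    (i j : Idx α) (h : i ≠ j) : f (down M a c α N (edge i j h)) =
      down M a c β N (edge (σ i) (σ j) (σ.injective.ne h)) := by
  obtain ⟨k, l, h', e⟩ := (isAtom_iff hM).1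
    ((OrderIso.isAtom_iff f _).2 ((isAtom_iff hM).2 ⟨i, j, h, rfl⟩))
  have h1 : ∀ m, atom m ≤ edge i j h → atom (σ m) ≤ edge k l h' := fun m hm => by
    rw [← down_le_down (M := M) (a := a) (c := c) (N := N), ← e, ← hσ, f.le_iff_le]
    exact down_le_down.2 hm
  rw [e, eq_of_edge_le_edge (edge_le_iff.2
    ⟨h1 i (atom_le_edge.2 (Or.inl rfl)), h1 j (atom_le_edge.2 (Or.inr rfl))⟩)]

/-! ### The copies of `N` in the lower part. -/

/-- The index of the lower edge that goes up to `h^i` from the atom of the pair `{i, j}`. -/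
noncomputable def lowerEdge (i j : Idx α) (h : i ≠ j) : SEdge α :=
  if h' : i < j then ⟨i, j, h', .lowerLeft⟩
  else ⟨j, i, lt_of_le_of_ne (not_lt.1 h') h.symm, .lowerRight⟩

theorem lo_lowerEdge (i j : Idx α) (h : i ≠ j) :
    (SEdge.family M a c α).lo (lowerEdge i j h) = S0.down M a c α (edge i j h) := by
  unfold lowerEdge edge
  split_ifs <;> rfl

theorem hi_lowerEdge (i j : Idx α) (h : i ≠ j) :
    (SEdge.family M a c α).hi (lowerEdge i j h) = S0.down M a c α (atom i) := by
  unfold lowerEdge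
  split_ifs <;> rfl

/-- The order of the indices is encoded here: the copy between `h_{ij}` and `h^i` is the dual of `N`
exactly when `i < j`. -/
theorem reversed_lowerEdge (i j : Idx α) (h : i ≠ j) :
    (SEdge.family M a c α).reversed (lowerEdge i j h) ↔ i < j := by
  unfold lowerEdge
  split_ifs with h' <;> simp [SEdge.family, SEdge.reversed, h']

theorem exists_eq_lowerEdge (hM : IsConnector M a c) {e : SEdge α} {t : TLat α}
    (he : (SEdge.family M a c α).hi e ≤ S0.down M a c α t) :
    ∃ i j h, e = lowerEdge i j h := by
  obtain ⟨i, j, h, _ | _⟩ := e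
  · exact (coatom_ne_bot ((S0.up_le_down hM).1 he).1).elim
  · exact (coatom_ne_bot ((S0.up_le_down hM).1 he).1).elim
  · exact ⟨i, j, h.ne, by simp [lowerEdge, h]⟩
  · exact ⟨j, i, h.ne', by simp [lowerEdge, h.not_gt]⟩

/-- The copy is a whole interval of `S(α)`, so an isomorphism that matches the endpoints matches the
copies. This needs that `h^i` covers `h_{ij}` in `S_0(α)` and that no other replaced edge lies
between them. -/
theorem exists_copy_eq_of_mem [Nontrivial N] (hM : IsConnector M a c) {i j : Idx α} (h : i ≠ j)
    {z : SLat M a c α N} (h1 : down M a c α N (edge i j h) ≤ z)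
    (h2 : z ≤ down M a c α N (atom i)) :
    ∃ x : N, EdgeReplace.copy (SEdge.family M a c α) (lowerEdge i j h) x = z := by
  refine exists_copy_eq ?_ ?_ (by rwa [lo_lowerEdge]) (by rwa [hi_lowerEdge])
  · refine ⟨(SEdge.family M a c α).lo_lt_hi _, fun x hx hx' => ?_⟩
    rw [lo_lowerEdge] at hx
    rw [hi_lowerEdge] at hx'
    rcases x with x | ⟨x, hx0⟩
    · rcases eq_or_eq_of_le_edge (x := OrderDual.ofDual x) hx'.le hx.le with h3 | h3
      · exact hx'.ne (congrArg _ h3)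
      · exact hx.ne (congrArg _ h3.symm)
    · exact Glue.not_upper_le_lower hx'.le
  · intro e' h3 h4
    rw [hi_lowerEdge] at h4
    rw [lo_lowerEdge] at h3
    obtain ⟨k, l, hkl, rfl⟩ := exists_eq_lowerEdge hM h4
    rw [lo_lowerEdge, S0.down_le_down] at h3
    rw [hi_lowerEdge, S0.down_le_down, atom_le_atom] at h4
    subst h4
    rw [edge_le_edge] at h3
    obtain rfl : l = j := by grind
    rfl

theorem down_edge_le_copy [Nontrivial N] {i j : Idx α} (h : i ≠ j) (x : N) :
    down M a c α N (edge i j h) ≤ EdgeReplace.copy (SEdge.family M a c α) (lowerEdge i j h) x := by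
  rw [down, ← lo_lowerEdge]
  exact lo_le_copy _ _

theorem copy_le_down_atom [Nontrivial N] {i j : Idx α} (h : i ≠ j) (x : N) :
    EdgeReplace.copy (SEdge.family M a c α) (lowerEdge i j h) x ≤ down M a c α N (atom i) := by
  rw [down, ← hi_lowerEdge]
  exact copy_le_hi _ _

/-- An isomorphism preserves the order of the indices and maps the copies of `N` in the lower part
canonically. -/
theorem map_copy (hM : IsConnector M a c) (hN : IsEdgeFiller N)
    (f : SLat M a c α N ≃o SLat M a c β N) {σ : Idx α ≃ Idx β}
    (hσ : ∀ i, f (down M a c α N (atom i)) = down M a c β N (atom (σ i)))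
    {i j : Idx α} (h : i ≠ j) : (i < j ↔ σ i < σ j) ∧ ∀ x : N,
      f (EdgeReplace.copy (SEdge.family M a c α) (lowerEdge i j h) x) =
        EdgeReplace.copy (SEdge.family M a c β) (lowerEdge (σ i) (σ j) (σ.injective.ne h)) x := by
  have := hN.simple.isSimpleOrderedSet.nontrivial
  have hσ' : σ i ≠ σ j := σ.injective.ne h
  have he := map_down_edge hM f hσ i j h
  have h1 : ∀ p : N, ∃ q : N, f (EdgeReplace.copy (SEdge.family M a c α) (lowerEdge i j h) p) =
      EdgeReplace.copy (SEdge.family M a c β) (lowerEdge (σ i) (σ j) hσ') q := fun p => by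
    obtain ⟨q, hq⟩ := exists_copy_eq_of_mem hM hσ'
      (he ▸ f.le_iff_le.2 (down_edge_le_copy h p)) (hσ i ▸ f.le_iff_le.2 (copy_le_down_atom h p))
    exact ⟨q, hq.symm⟩
  have h2 : ∀ q : N, ∃ p : N, f (EdgeReplace.copy (SEdge.family M a c α) (lowerEdge i j h) p) =
      EdgeReplace.copy (SEdge.family M a c β) (lowerEdge (σ i) (σ j) hσ') q := fun q => by
    obtain ⟨p, hp⟩ := exists_copy_eq_of_mem hM h
      (f.le_symm_apply.2 (he ▸ down_edge_le_copy hσ' q))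
      (f.symm_apply_le.2 (hσ i ▸ copy_le_down_atom hσ' q))
    exact ⟨p, by rw [hp, f.apply_symm_apply]⟩
  -- `copy` is an order embedding of `Nᵒᵈ` for `k < l`, and of `N` otherwise.
  have hr : ∀ {γ : Ordinal.{u}} {k l : Idx γ} (hkl : k ≠ l), k < l → ∀ p q : Nᵒᵈ,
      EdgeReplace.copy (SEdge.family M a c γ) (lowerEdge k l hkl) (OrderDual.ofDual p) ≤
      EdgeReplace.copy (SEdge.family M a c γ) (lowerEdge k l hkl) (OrderDual.ofDual q) ↔ p ≤ q := by
    intro γ k l hkl hlt p q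
    rw [copy_le_copy, if_pos ((reversed_lowerEdge k l hkl).2 hlt)]
    rfl
  have hn : ∀ {γ : Ordinal.{u}} {k l : Idx γ} (hkl : k ≠ l), ¬ k < l → ∀ p q : N,
      EdgeReplace.copy (SEdge.family M a c γ) (lowerEdge k l hkl) p ≤
      EdgeReplace.copy (SEdge.family M a c γ) (lowerEdge k l hkl) q ↔ p ≤ q := by
    intro γ k l hkl hlt p q
    rw [copy_le_copy, if_neg (fun h => hlt ((reversed_lowerEdge k l hkl).1 h))]
  -- The two mixed cases would give an isomorphism between `N` and `Nᵒᵈ`; the other two give an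
  -- automorphism of `N` or of its dual, which is the identity.
  by_cases h3 : i < j <;> by_cases h4 : σ i < σ j
  · obtain ⟨F, hF⟩ := exists_orderIso_of_embedding (hr h h3) (hr hσ' h4) f h1 h2
    have hF' : F.dual = OrderIso.refl N := hN.rigid F.dual
    refine ⟨iff_of_true h3 h4, fun x => ?_⟩
    have h5 : F (OrderDual.toDual x) = OrderDual.toDual x := congrArg (fun g => g x) hF'
    have h6 := hF (OrderDual.toDual x)
    rwa [h5] at h6
  · obtain ⟨F, hF⟩ := exists_orderIso_of_embedding (hr h h3) (hn hσ' h4) f h1 h2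
    exact (hN.not_selfdual ⟨F.symm⟩).elim
  · obtain ⟨F, hF⟩ := exists_orderIso_of_embedding (hn h h3) (hr hσ' h4) f h1 h2
    exact (hN.not_selfdual ⟨F⟩).elim
  · obtain ⟨F, hF⟩ := exists_orderIso_of_embedding (hn h h3) (hn hσ' h4) f h1 h2
    refine ⟨iff_of_false h3 h4, fun x => ?_⟩
    rw [hF, hN.rigid F, OrderIso.refl_apply]

/-! ### Recovery of `α`, and rigidity. -/

theorem exists_indexIso (hM : IsConnector M a c) (hN : IsEdgeFiller N)
    (f : SLat M a c α N ≃o SLat M a c β N) :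
    ∃ σ : Idx α ≃o Idx β, ∀ i, f (down M a c α N (atom i)) = down M a c β N (atom (σ i)) := by
  obtain ⟨σ, hσ⟩ := exists_indexEquiv hM f
  refine ⟨⟨σ, fun {i j} => ?_⟩, hσ⟩
  rcases eq_or_ne i j with rfl | h
  · simp
  · rw [← not_lt, ← not_lt, (map_copy hM hN f hσ h.symm).1]

/-- The initial segments below `6 + α` and `6 + β` have the same order type, and ordinal addition is
left cancellative. -/
theorem eq_of_orderIso (hM : IsConnector M a c) (hN : IsEdgeFiller N)
    (f : SLat M a c α N ≃o SLat M a c β N) : α = β := by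
  obtain ⟨σ, -⟩ := exists_indexIso hM hN f
  have h := σ.toRelIsoLT.ordinal_lift_type_eq
  simp only [Ordinal.type_lt_Iio, Ordinal.lift_lift] at h
  simpa using h

/-- An automorphism fixes the lower part. -/
theorem apply_eq_of_le (hM : IsConnector M a c) (hN : IsEdgeFiller N)
    (f : SLat M a c α N ≃o SLat M a c α N) {x : SLat M a c α N} (hx : x ≤ down M a c α N ⊥) :
    f x = x := by
  have := hN.simple.isSimpleOrderedSet.nontrivial
  obtain ⟨σ, hσ⟩ := exists_indexIso hM hN f
  -- A well-ordered set has no automorphism but the identity.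
  obtain rfl : σ = OrderIso.refl _ := Subsingleton.elim _ _
  have hdown : ∀ t, f (down M a c α N t) = down M a c α N t := fun t => by
    obtain rfl | rfl | ⟨i, rfl⟩ | ⟨i, j, h, rfl⟩ := eq_cases t
    · exact map_down_bot hM f
    · exact map_bot f
    · exact hσ i
    · exact map_down_edge hM f (σ := Equiv.refl _) hσ i j h
  have hmid : ∀ m, S0.mid M a c α m ≤ S0.down M a c α ⊥ →
      f (mid M a c α N m) = mid M a c α N m := fun m hm => by
    have hm' : m ≤ a := by
      rcases (S0.mid_le_down hM).1 hm with ⟨rfl, -⟩ | ⟨h, -⟩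
      · exact bot_le
      · exact h
    rcases hM.atom.le_iff.1 hm' with rfl | rfl
    · rw [mid, S0.mid_bot hM]
      exact hdown _
    · rw [mid, S0.mid_atom hM]
      exact hdown _
  obtain x | ⟨e, s⟩ := x
  · obtain ⟨t, rfl⟩ | ⟨m, rfl⟩ | ⟨t, rfl⟩ := S0.exists_eq x
    · exact hdown t
    · exact hmid m hx
    -- An element of `T(α)` lies here only if it is the point `c` and `c ≤ a`.
    · obtain ⟨rfl, -⟩ := (S0.up_le_down hM).1 (base_le_base.1 hx)
      rw [← S0.mid_coatom hM] at hx ⊢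
      exact hmid c hx
  · obtain ⟨i, j, h, rfl⟩ := exists_eq_lowerEdge hM (inner_le_base.1 hx)
    rw [← copy_coe]
    exact (map_copy hM hN f (σ := Equiv.refl _) hσ h).2 s

theorem isAutomorphismRigid (hM : IsConnector M a c) (hN : IsEdgeFiller N) (α : Ordinal.{u}) :
    IsAutomorphismRigid (SLat M a c α N) := by
  intro f
  obtain ⟨G, hG⟩ := exists_dualIso hM N α
  have hup : ∀ x, up M a c α N ⊥ ≤ x → f x = x := fun x hx => by
    -- Conjugating `f` by the dual automorphism gives an automorphism, which fixes the lower part;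
    -- transported back, `f` fixes the upper part.
    let g : SLat M a c α N ≃o SLat M a c α N := ((G.symm.trans f).trans G).dual
    have hle : OrderDual.ofDual (G x) ≤ down M a c α N ⊥ := by
      have := G.le_iff_le.2 hx
      rwa [up, hG] at this
    have h1 : G (f (G.symm (G x))) = G x := apply_eq_of_le hM hN g hle
    rw [G.symm_apply_apply] at h1
    exact G.injective h1
  have hlow : ∀ x, x ≤ down M a c α N ⊥ → f x = x := fun x hx => apply_eq_of_le hM hN f hx
  have hmle : ∀ p q, mid M a c α N p ≤ mid M a c α N q ↔ p ≤ q := fun p q => S0.mid_le_mid hM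
  have hbot : f (mid M a c α N ⊥) = mid M a c α N ⊥ := by
    rw [mid, S0.mid_bot hM]
    exact hlow _ (down_le_down.2 bot_le)
  have htop : f (mid M a c α N ⊤) = mid M a c α N ⊤ := by
    rw [mid, S0.mid_top hM]
    exact hup _ ((S0.up_le_up hM).2 bot_le)
  have ha : f (mid M a c α N a) = mid M a c α N a := by
    rw [mid, S0.mid_atom hM]
    exact hlow _ le_rfl
  have hc : f (mid M a c α N c) = mid M a c α N c := by
    rw [mid, S0.mid_coatom hM]
    exact hup _ le_rfl
  -- `M` is the full interval between its bottom and its top: no inserted element lies there, and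
  -- from `T'(α)` and `T(α)` only shared points do. Hence `f` restricts to `M`.
  have hrange : ∀ x, mid M a c α N ⊥ ≤ x → x ≤ mid M a c α N ⊤ → ∃ m, x = mid M a c α N m := by
    rintro (x | ⟨e, s⟩) h1 h2
    · obtain ⟨t, rfl⟩ | ⟨m, rfl⟩ | ⟨t, rfl⟩ := S0.exists_eq x
      · obtain ⟨-, h3⟩ | ⟨-, rfl⟩ := (S0.mid_le_down hM).1 h1
        · rcases (isAtom_atom _).le_iff.1 h3 with rfl | rfl
          · exact ⟨a, congrArg _ (S0.mid_atom hM).symm⟩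
          · exact ⟨⊥, congrArg _ (S0.mid_bot hM).symm⟩
        · exact ⟨a, congrArg _ (S0.mid_atom hM).symm⟩
      · exact ⟨m, rfl⟩
      · obtain ⟨rfl, -⟩ | ⟨h3, -⟩ := (S0.up_le_mid hM).1 h2
        · exact ⟨c, congrArg _ (S0.mid_coatom hM).symm⟩
        · rcases (isAtom_atom _).le_iff.1 h3 with rfl | rfl
          · exact ⟨c, congrArg _ (S0.mid_coatom hM).symm⟩
          · exact ⟨⊤, congrArg _ (S0.mid_top hM).symm⟩
    · have hu : ∀ i j h, ¬ S0.up M a c α (.coatom i j h) ≤ S0.mid M a c α ⊤ := fun i j h h3 => by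
        obtain ⟨h4, -⟩ | ⟨h4, -⟩ := (S0.up_le_mid hM).1 h3
        · exact coatom_ne_bot h4
        · exact not_coatom_le_atom h4
      have hd : ∀ i j h, ¬ S0.mid M a c α ⊥ ≤ S0.down M a c α (.coatom i j h) := fun i j h h3 => by
        obtain ⟨-, h4⟩ | ⟨-, h4⟩ := (S0.mid_le_down hM).1 h3
        · exact not_coatom_le_atom h4
        · exact coatom_ne_bot h4
      obtain ⟨i, j, h, _ | _⟩ := e
      · exact (hu i j h (inner_le_base.1 h2)).elim
      · exact (hu i j h (inner_le_base.1 h2)).elim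
      · exact (hd i j h (base_le_inner.1 h1)).elim
      · exact (hd i j h (base_le_inner.1 h1)).elim
  have hmid : ∀ m, f (mid M a c α N m) = mid M a c α N m := by
    obtain ⟨F, hF⟩ := exists_orderIso_of_embedding hmle hmle f
      (fun p => hrange _ (hbot ▸ f.le_iff_le.2 ((hmle _ _).2 bot_le))
        (htop ▸ f.le_iff_le.2 ((hmle _ _).2 le_top)))
      (fun q => by
        obtain ⟨p, hp⟩ := hrange (f.symm (mid M a c α N q))
          (f.le_symm_apply.2 (hbot.le.trans ((hmle _ _).2 bot_le)))
          (f.symm_apply_le.2 (((hmle _ _).2 le_top).trans htop.ge))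
        exact ⟨p, by rw [← hp, f.apply_symm_apply]⟩)
    have hinj : ∀ p q, mid M a c α N p = mid M a c α N q → p = q := fun p q h =>
      le_antisymm ((hmle p q).1 h.le) ((hmle q p).1 h.ge)
    have h1 := hM.rigid F (hinj _ _ ((hF a).symm.trans ha)) (hinj _ _ ((hF c).symm.trans hc))
    intro m
    rw [hF, h1, OrderIso.refl_apply]
  ext x
  change f x = x
  obtain x | ⟨e, s⟩ := x
  · obtain ⟨t, rfl⟩ | ⟨m, rfl⟩ | ⟨t, rfl⟩ := S0.exists_eq x
    · exact hlow _ (down_le_down.2 bot_le)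
    · exact hmid m
    · exact hup _ ((S0.up_le_up hM).2 bot_le)
  · obtain ⟨i, j, h, _ | _⟩ := e
    · exact hup _ ((S0.up_le_up hM).2 bot_le)
    · exact hup _ ((S0.up_le_up hM).2 bot_le)
    · exact hlow _ (inner_le_base.2 (S0.down_le_down.2 bot_le))
    · exact hlow _ (inner_le_base.2 (S0.down_le_down.2 bot_le))

theorem properties (hM : IsConnector M a c) (hN : IsEdgeFiller N) :
    (∀ α : Ordinal.{u},
        IsAutomorphismRigid (SLat M a c α N) ∧ IsSimpleLattice (SLat M a c α N) ∧
        IsSelfdual (SLat M a c α N) ∧ HasLength (SLat M a c α N) 12) ∧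
      (∀ α β : Ordinal.{u}, Nonempty (SLat M a c α N ≃o SLat M a c β N) ↔ α = β) := by
  refine ⟨fun α => ⟨isAutomorphismRigid hM hN α, (isSimpleOrderedSet hM hN α).isSimpleLattice,
    ⟨(exists_dualIso hM N α).choose⟩, hasLength hM hN α⟩,
    fun α β => ⟨fun ⟨f⟩ => eq_of_orderIso hM hN f, ?_⟩⟩
  rintro rfl
  exact ⟨OrderIso.refl _⟩

end SLat

/-! ### The two diagrams -/

section Finite

variable {X : Type u} [PartialOrder X]

/-- A criterion for simplicity: a lattice polynomial maps each pair of comparable elements to a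
fixed pair `(p, ⊤)`, and every congruence that collapses this pair collapses everything. -/
theorem isSimpleOrderedSet_of_polynomial [BoundedOrder X] [Nontrivial X] {sup inf : X → X → X}
    (hsup : ∀ x y, IsLUB {x, y} (sup x y)) (hinf : ∀ x y, IsGLB {x, y} (inf x y)) (p : X)
    (hw : ∀ u v, u < v → ∃ z₀ z₁ z₂, sup (inf (sup (inf u z₀) z₁) z₂) p = p ∧
      sup (inf (sup (inf v z₀) z₁) z₂) p = ⊤)
    (hp : ∀ r : X → X → Prop, IsOrderCongruence r → r p ⊤ → r ⊥ ⊤) : IsSimpleOrderedSet X where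
  exists_isLUB x y := ⟨_, hsup x y⟩
  exists_isGLB x y := ⟨_, hinf x y⟩
  nontrivial := inferInstance
  eq_or_full r hr := by
    by_cases h : ∃ u v, u < v ∧ r u v
    · right
      obtain ⟨u, v, huv, h⟩ := h
      obtain ⟨z₀, z₁, z₂, h1, h2⟩ := hw u v huv
      have h3 := hr.lub (hr.glb (hr.lub (hr.glb h (hinf u z₀) (hinf v z₀)) (hsup _ z₁) (hsup _ z₁))
        (hinf _ z₂) (hinf _ z₂)) (hsup _ p) (hsup _ p)
      rw [h1, h2] at h3
      exact hr.full_of_le (fun _ => bot_le) (fun _ => le_top) (hp r hr h3)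
    · left
      push Not at h
      exact hr.eq_of_not_lt (fun x y => ⟨_, hsup x y⟩) h

variable [Fintype X] [DecidableLE X]

/-- The sum of the weights of the elements below a given element. -/
def sumBelow (w : X → ℕ) (x : X) : ℕ := ∑ y, if y ≤ x then w y else 0

/-- The sum of the weights of the elements above a given element. -/
def sumAbove (w : X → ℕ) (x : X) : ℕ := ∑ y, if x ≤ y then w y else 0

/-- Automorphism-invariant weights yield new invariant weights. If some iterate is injective, every
automorphism that preserves the initial weight is the identity. -/
theorem sumBelow_apply (f : X ≃o X) {w : X → ℕ} (hw : ∀ x, w (f x) = w x) (x : X) :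
    sumBelow w (f x) = sumBelow w x := by
  unfold sumBelow
  rw [← f.toEquiv.sum_comp]
  simp [hw]

theorem sumAbove_apply (f : X ≃o X) {w : X → ℕ} (hw : ∀ x, w (f x) = w x) (x : X) :
    sumAbove w (f x) = sumAbove w x := by
  unfold sumAbove
  rw [← f.toEquiv.sum_comp]
  simp [hw]

end Finite

/-! ### The lattice `M'_{3×3}`. -/

namespace M33

instance : DecidableLE M33 := fun x y => inferInstanceAs (Decidable (x = y ∨ ceil x ≤ floor y))

instance : Nontrivial M33 := ⟨e, f, by decide⟩

/-- The join. -/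
def sup (x y : M33) : M33 :=
  if x ≤ y then y else if y ≤ x then x
  else grid (max (ceil x).1 (ceil y).1) (max (ceil x).2 (ceil y).2)

/-- The meet. -/
def inf (x y : M33) : M33 :=
  if x ≤ y then x else if y ≤ x then y
  else grid (min (floor x).1 (floor y).1) (min (floor x).2 (floor y).2)

theorem isLUB_sup (x y : M33) : IsLUB {x, y} (sup x y) := by
  rw [isLUB_pair_iff]
  revert x y
  decide +kernel

theorem isGLB_inf (x y : M33) : IsGLB {x, y} (inf x y) := by
  rw [isGLB_pair_iff]
  revert x y
  decide +kernel

theorem isSimpleOrderedSet : IsSimpleOrderedSet M33 := by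
  refine isSimpleOrderedSet_of_polynomial isLUB_sup isGLB_inf (grid 2 0) ?_ fun r hr h => ?_
  -- A meet with the atom `f` is `f` or `⊥`, and the join with `(2,0)` turns these into `⊤` and
  -- `(2,0)`.
  · have h : ∀ u v : M33, u ≤ v → u = v ∨ ∃ z₀ z₁,
        sup (inf (sup (inf u z₀) z₁) f) (grid 2 0) = grid 2 0 ∧
          sup (inf (sup (inf v z₀) z₁) f) (grid 2 0) = grid 2 2 := by decide +kernel
    intro u v huv
    obtain ⟨z₀, z₁, h'⟩ := (h u v huv.le).resolve_left huv.ne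
    exact ⟨z₀, z₁, f, h'⟩
  · have join : ∀ {x y} z, r x y → r (sup x z) (sup y z) := fun z h =>
      hr.lub h (isLUB_sup _ z) (isLUB_sup _ z)
    have meet : ∀ {x y} z, r x y → r (inf x z) (inf y z) := fun z h =>
      hr.glb h (isGLB_inf _ z) (isGLB_inf _ z)
    -- The middle element of a cell transfers the collapse of its left side in the second coordinate
    -- to a side in the first; collapsed pairs then link `(0,0)`, `(1,0)`, `(2,0)` and `(2,2)`.
    have h1 : r (grid 0 0) (grid 0 1) := meet (grid 0 1) h
    have h2 : r (grid 0 0) (grid 1 0) := meet (grid 1 0) (join (mid 0 0) h1)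
    have h3 : r (grid 1 0) (grid 2 0) := meet (grid 2 0) (join (mid 1 0) h1)
    exact hr.equiv.trans (hr.equiv.trans h2 h3) h

theorem hasLength : HasLength M33 4 := by
  let φ : M33 → ℕ := fun
    | grid i j => i + j
    | mid i j => i + j + 1
    | e => 3
    | f => 1
  have hφ : ∀ x y : M33, x ≤ y → x = y ∨ φ x < φ y := by decide +kernel
  have hs : StrictMono ![grid 0 0, grid 1 0, grid 1 1, grid 1 2, grid 2 2] :=
    Fin.strictMono_iff_lt_succ.2 fun i => by
      have h : ∀ i : Fin 4, ![grid 0 0, grid 1 0, grid 1 1, grid 1 2, grid 2 2] i.castSucc ≤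
          ![grid 0 0, grid 1 0, grid 1 1, grid 1 2, grid 2 2] i.succ ∧
          ![grid 0 0, grid 1 0, grid 1 1, grid 1 2, grid 2 2] i.castSucc ≠
          ![grid 0 0, grid 1 0, grid 1 1, grid 1 2, grid 2 2] i.succ := by decide +kernel
      exact lt_of_le_of_ne (h i).1 (h i).2
  exact hasLength_of_strictMono (φ := φ) (fun x y h => (hφ x y h.le).resolve_left h.ne)
    (by decide +kernel) hs

/-- The rotation of the diagram by a half-turn. -/
def rotate : M33 → M33
  | grid i j => grid i.rev j.rev
  | mid i j => mid i.rev j.rev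
  | e => f
  | f => e

theorem isConnector : IsConnector M33 (grid 1 0) (grid 1 2) where
  simple := isSimpleOrderedSet.isSimpleLattice
  length := hasLength
  atom := by
    have h : ∀ x : M33, x ≤ grid 1 0 → x = grid 1 0 ∨ x = grid 0 0 := by decide +kernel
    exact ⟨by decide, fun x hx => (h x hx.le).resolve_left hx.ne⟩
  coatom := by
    have h : ∀ x : M33, grid 1 2 ≤ x → x = grid 1 2 ∨ x = grid 2 2 := by decide +kernel
    exact ⟨by decide, fun x hx => (h x hx.le).resolve_left hx.ne'⟩
  selfdual := by
    have h1 : ∀ x, rotate (rotate x) = x := by decide +kernel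
    have h2 : ∀ x y, rotate y ≤ rotate x ↔ x ≤ y := by decide +kernel
    exact ⟨⟨⟨fun x => OrderDual.toDual (rotate x), fun x => rotate (OrderDual.ofDual x), h1, h1⟩,
      fun {x y} => h2 x y⟩, rfl, rfl⟩
  rigid g ha _ := by
    -- The weight singles out the fixed atom `a`; summing above and then below separates all 15
    -- elements.
    let w : M33 → ℕ := fun x => if x = grid 1 0 then 2 else 1
    have hw : ∀ x, w (g x) = w x := fun x => by
      have h : g x = grid 1 0 ↔ x = grid 1 0 := by
        rw [← g.injective.eq_iff (a := x), ha]
      simp only [w, h]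
    have hinj : ∀ x y, sumBelow (sumAbove w) x = sumBelow (sumAbove w) y → x = y := by
      decide +kernel
    ext x
    exact hinj _ _ (sumBelow_apply g (sumAbove_apply g hw) x)

end M33

/-! ### The lattice `N_11`. -/

namespace N11

instance : DecidableLE N11 := fun
  | bot, bot => isTrue trivial
  | bot, top => isTrue trivial
  | bot, atom _ => isTrue trivial
  | bot, coatom _ => isTrue trivial
  | top, bot => isFalse id
  | top, top => isTrue trivial
  | top, atom _ => isFalse id
  | top, coatom _ => isFalse id
  | atom _, bot => isFalse id
  | atom _, top => isTrue trivial
  | atom i, atom k => inferInstanceAs (Decidable (i = k))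
  | atom i, coatom j => inferInstanceAs (Decidable (i ∈ atomsBelow j))
  | coatom _, bot => isFalse id
  | coatom _, top => isTrue trivial
  | coatom _, atom _ => isFalse id
  | coatom j, coatom k => inferInstanceAs (Decidable (j = k))

instance : Nontrivial N11 := ⟨bot, top, by decide⟩

/-- The join. -/
def sup (x y : N11) : N11 :=
  if x ≤ y then y else if y ≤ x then x
  else if x ≤ coatom 0 ∧ y ≤ coatom 0 then coatom 0
  else if x ≤ coatom 1 ∧ y ≤ coatom 1 then coatom 1
  else top

/-- The meet. -/
def inf (x y : N11) : N11 :=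
  if x ≤ y then x else if y ≤ x then y
  else if atom 0 ≤ x ∧ atom 0 ≤ y then atom 0
  else if atom 2 ≤ x ∧ atom 2 ≤ y then atom 2
  else if atom 3 ≤ x ∧ atom 3 ≤ y then atom 3
  else bot

theorem isLUB_sup (x y : N11) : IsLUB {x, y} (sup x y) := by
  rw [isLUB_pair_iff]
  revert x y
  decide +kernel

theorem isGLB_inf (x y : N11) : IsGLB {x, y} (inf x y) := by
  rw [isGLB_pair_iff]
  revert x y
  decide +kernel

theorem isSimpleOrderedSet : IsSimpleOrderedSet N11 := by
  refine isSimpleOrderedSet_of_polynomial isLUB_sup isGLB_inf (atom 2) ?_ fun r hr h => ?_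
  · have h : ∀ u v : N11, u ≤ v → u = v ∨ ∃ z₀ z₁ z₂,
        sup (inf (sup (inf u z₀) z₁) z₂) (atom 2) = atom 2 ∧
          sup (inf (sup (inf v z₀) z₁) z₂) (atom 2) = top := by decide +kernel
    exact fun u v huv => (h u v huv.le).resolve_left huv.ne
  -- From `p_2 ∼ ⊤`, meets give `⊥ ∼ p_0` and `⊥ ∼ p_3`; no coatom is above both `p_0` and `p_3`, so
  -- joining the former with `p_3` gives `p_3 ∼ ⊤`.
  · have h1 : r bot (atom 0) := hr.glb h (isGLB_inf _ (atom 0)) (isGLB_inf _ (atom 0))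
    have h2 : r bot (atom 3) := hr.glb h (isGLB_inf _ (atom 3)) (isGLB_inf _ (atom 3))
    have h3 : r (atom 3) top := hr.lub h1 (isLUB_sup _ (atom 3)) (isLUB_sup _ (atom 3))
    exact hr.equiv.trans h2 h3

theorem hasLength : HasLength N11 3 := by
  let φ : N11 → ℕ := fun
    | bot => 0
    | atom _ => 1
    | coatom _ => 2
    | top => 3
  have hφ : ∀ x y : N11, x ≤ y → x = y ∨ φ x < φ y := by decide +kernel
  have hs : StrictMono ![bot, atom 0, coatom 0, top] :=
    Fin.strictMono_iff_lt_succ.2 fun i => by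
      have h : ∀ i : Fin 3, ![bot, atom 0, coatom 0, top] i.castSucc ≤
          ![bot, atom 0, coatom 0, top] i.succ ∧
          ![bot, atom 0, coatom 0, top] i.castSucc ≠
          ![bot, atom 0, coatom 0, top] i.succ := by decide +kernel
      exact lt_of_le_of_ne (h i).1 (h i).2
  exact hasLength_of_strictMono (φ := φ) (fun x y h => (hφ x y h.le).resolve_left h.ne)
    (by decide +kernel) hs

theorem isEdgeFiller : IsEdgeFiller N11 where
  simple := isSimpleOrderedSet.isSimpleLattice
  length := hasLength
  rigid g := by
    have hinj : ∀ x y : N11, sumBelow (sumAbove (sumBelow 1)) x =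
        sumBelow (sumAbove (sumBelow 1)) y → x = y := by decide +kernel
    ext x
    exact hinj _ _ (sumBelow_apply g (sumAbove_apply g (sumBelow_apply g fun _ => rfl)) x)
  not_selfdual := by
    rintro ⟨g⟩
    let k : N11 → N11 := fun x => OrderDual.ofDual (g x)
    have hk : ∀ x, sumAbove 1 x = sumBelow 1 (k x) := fun x => by
      unfold sumBelow sumAbove
      rw [← (g.toEquiv.trans OrderDual.ofDual).sum_comp (fun y => if y ≤ k x then (1 : N11 → ℕ) y
        else 0)]
      have h : ∀ y, k y ≤ k x ↔ x ≤ y := fun y => g.le_iff_le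
      exact Finset.sum_congr rfl fun y _ => if_congr (h y).symm rfl rfl
    -- A duality matches the sizes of principal filters with those of principal ideals. Their plain
    -- sums agree in every finite poset, both counting comparable pairs; sums of squares tell them
    -- apart.
    have h1 : ∑ x : N11, sumAbove 1 x ^ 2 = ∑ x : N11, sumBelow 1 x ^ 2 := by
      rw [← (g.toEquiv.trans OrderDual.ofDual).sum_comp (fun x => sumBelow 1 x ^ 2)]
      exact Finset.sum_congr rfl fun x _ => congrArg (· ^ 2) (hk x)
    have h2 : ∑ x : N11, sumAbove 1 x ^ 2 ≠ ∑ x : N11, sumBelow 1 x ^ 2 := by decide +kernel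
    exact h2 h1

end N11

theorem mainTheorem2 :
    -- the lattices `S(α)`
    (∀ α : Ordinal.{u},
      IsAutomorphismRigid (S α) ∧ IsSimpleLattice (S α) ∧ IsSelfdual (S α) ∧ HasLength (S α) 12) ∧
    (∀ α β : Ordinal.{u}, Nonempty (S α ≃o S β) ↔ α = β) ∧
    -- the diagrams of `M'_{3×3}` and `N_11` have the properties needed, and the same
    -- holds for any choice of diagrams with these properties
    IsConnector M33 (M33.grid 1 0) (M33.grid 1 2) ∧
    IsEdgeFiller N11 ∧
    (∀ (M : Type) [PartialOrder M] [BoundedOrder M] (a c : M)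
      (N : Type) [PartialOrder N] [BoundedOrder N], IsConnector M a c → IsEdgeFiller N →
      (∀ α : Ordinal.{u},
        IsAutomorphismRigid (SLat M a c α N) ∧ IsSimpleLattice (SLat M a c α N) ∧
        IsSelfdual (SLat M a c α N) ∧ HasLength (SLat M a c α N) 12) ∧
      (∀ α β : Ordinal.{u}, Nonempty (SLat M a c α N ≃o SLat M a c β N) ↔ α = β)) :=
  ⟨(SLat.properties M33.isConnector N11.isEdgeFiller).1,
    (SLat.properties M33.isConnector N11.isEdgeFiller).2, M33.isConnector, N11.isEdgeFiller,
    fun _ _ _ _ _ _ _ _ hM hN => SLat.properties hM hN⟩
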